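/- Let $T=e^{-e}/2$ and let $\tilde w(t)=t\sin\log\log\log(1/|t|)$ for $t\ne0$, $\tilde w(0)=0$. For $u\colon[-T,T]\to\mathbb R$ and $s\in[-T,T]$ let $\overline Du(s)$ and $\underline Du(s)$ be the $\limsup$ and $\liminf$, in $[-\infty,\infty]$, of $\frac{u(t)-u(s)}{t-s}$ as $t\to s$, $t\in[-T,T]\setminus\{s\}$. Put $\psi(0)=0$ and, for $t\neq0$, $$\psi(t)=\frac{402}{|t|\log\log\frac1{5|t|}}+3+4|\tilde w''(t)|,$$ and let $C=1+\sup_{|t|\le T}5|t|\psi(t)$ and $\epsilon_n=2^{-n}(1-e^{-1})$. Let $(x_n)_{n\ge0}$ be a sequence of distinct points of $(-T,T)$ with $x_0=0$. Put $\tilde w_n(t)=\tilde w(t-x_n)$, $\psi_n(t)=\psi(t-x_n)$, and $\sigma_n=\frac12\min_{i<n}|x_i-x_n|$ for $n\ge1$. **Construction.** Choose the following constants. * $K_0=1$ and, for $n\ge1$, $K_n\ge1+K_{n-1}$ with $2\sum_{i<n}|\tilde w_i''(t)|\le K_n$ for all $t\in[-T,T]$ with $|x_i-t|\ge\sigma_n$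 for all $i<n$. * $T_0=T$ and, for $n\ge1$, $T_n\in(0,1)$ with $Y_n:=[x_n-T_n,x_n+T_n]\subseteq[-T,T]$, $T_n<\sigma_n$, $T_n<T_{n-1}/2$, $|(t-x_n)\psi_n(t)|<2^{-n}/5$ on $Y_n$, and $T_n<K_n^{-1}$. * For $n\ge0$: an integer $m_n>n$ with $2^{-m_n}<T_{n+1}^2/256$; an open set $G_n\subseteq[-T,T]$ containing $x_0,\dots,x_{m_n}$, of measure at most $T_{n+1}^2/(16C)$; and $M_n>1$ with $\sum_{i=0}^{m_n}\max\{\psi_i(t),\psi_i(x_i+T_i)\}\le M_n$ for all $t\in[-T,T]\setminus G_n$. * $R_0=T_0$ and, for $n\ge1$, $R_n\in(0,T_n]$ with $\frac1{(\log\log 1/R_n)(\log 1/R_n)}<\epsilon_n/2$, $R_n<R_{n-1}/2$ and $R_n<\frac{2^{-n}T_n^3\epsilon_n}{128\cdot25\,M_{n-1}}$. Put $Z_n=[x_n-R_n,x_n+R_n]$. Define functions $w_n$ on $[-T,T]$ inductively. Let $w_0=\tilde w_0$. For $n\ge1$ let $m=w_{n-1}'(x_n)$, and choose $\alpha_n\in[1,2)$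 and $\tau_n\in(0,R_n]$ such that $|\alpha_n\tilde w_n'|<2-\epsilon_n$ on $Z_n\setminus\{x_n\}$ and $\alpha_n\tilde w_n'(x_n-\tau_n)=m$ (equivalently $\alpha_n\tilde w_n'(x_n+\tau_n)=m$). Let $$\delta_l=m-w_{n-1}'(x_n-R_n),\qquad \delta_r=m-w_{n-1}'(x_n+R_n),$$ $$c_l=w_{n-1}(x_n)+\alpha_n\tilde w_n(x_n-\tau_n)-m(x_n-\tau_n)-w_{n-1}(x_n-R_n)+m(x_n-R_n),$$ $$c_r=w_{n-1}(x_n)+\alpha_n\tilde w_n(x_n+\tau_n)-m(x_n+\tau_n)-w_{n-1}(x_n+R_n)+m(x_n+R_n),$$ $$d_l=\tfrac4{T_n}\bigl(c_l-\tfrac{\delta_l}2(\tfrac{T_n}2-R_n)\bigr),\qquad d_r=\tfrac4{T_n}\bigl(c_r+\tfrac{\delta_r}2(\tfrac{T_n}2-R_n)\bigr).$$ Let $g_l$ be the continuous piecewise affine function equal to $0$ for $t\le x_n-T_n$, to $d_l$ at $x_n-\frac34T_n$, to $0$ at $x_n-\frac12T_n$, to $\delta_l$ for $t\ge x_n-R_n$,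 and affine in between. Let $g_r$ be the continuous piecewise affine function equal to $\delta_r$ for $t\le x_n+R_n$, to $0$ at $x_n+\frac12T_n$, to $-d_r$ at $x_n+\frac34T_n$, to $0$ for $t\ge x_n+T_n$, and affine in between. Put $\chi_l(t)=\int_{-T}^tg_l$ and $\chi_r(t)=c_r-\delta_r(x_n+R_n+T)+\int_{-T}^tg_r$. Then $$w_n(t)=\begin{cases}w_{n-1}(t)+\chi_l(t)&t\le x_n-R_n,\\ mt+w_{n-1}(x_n-R_n)-m(x_n-R_n)+c_l&x_n-R_n<t<x_n-\tau_n,\\ \alpha_n\tilde w_n(t)+w_{n-1}(x_n)&x_n-\tau_n\le t\le x_n+\tau_n,\\ mt+w_{n-1}(x_n+R_n)-m(x_n+R_n)+c_r&x_n+\tau_n<t<x_n+R_n,\\ w_{n-1}(t)+\chi_r(t)&x_n+R_n\le t.\end{cases}$$ **Proposition 4.1.** The construction can be carried out for every such sequence $(x_n)$. However the choices in it are made, $w_n$ converges uniformly on $[-T,T]$ to a function $w$, and for every $n\ge0$ $$\overline Dw(x_n)\ge1\quad\text{and}\quad\underline Dw(x_n)\le-1 .$$ In particular $w$ is not differentiable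 at any $x_n$. If moreover $\{x_n\}$ is dense in $[-T,T]$ (for instance, if $(x_n)$ enumerates the rationals in $(-T,T)$), then $$\Sigma=\{s\in(-T,T):\overline Dw(s)\ge1\text{ and }\underline Dw(s)\le-1\}$$ is a $G_\delta$ set that is dense in $[-T,T]$, and it is not meagre. -/

import Mathlib

open Set Filter Topology MeasureTheory

noncomputable section

namespace SingularMinimizer

/-- The half-length `T = e^{-e} / 2` of the interval `[-T, T]`. -/
def halfLen : ℝ := Real.exp (-Real.exp 1) / 2

/-- The interval `[-T, T]`. -/
def dom : Set ℝ := Icc (-halfLen) halfLen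

/-- The upper Dini derivative (with values in the extended reals) of `u : [a, b] → ℝ` at `x`:
the limsup of the difference quotients as `t → x`, `t ∈ [a, b]`, `t ≠ x`. -/
def upperDini (a b : ℝ) (u : ℝ → ℝ) (x : ℝ) : EReal :=
  limsup (fun t : ℝ => (((u t - u x) / (t - x) : ℝ) : EReal)) (𝓝[Icc a b \ {x}] x)

/-- The lower Dini derivative of `u : [a, b] → ℝ` at `x`. -/
def lowerDini (a b : ℝ) (u : ℝ → ℝ) (x : ℝ) : EReal :=
  liminf (fun t : ℝ => (((u t - u x) / (t - x) : ℝ) : EReal)) (𝓝[Icc a b \ {x}] x)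

/-- The basic singular function `t ↦ t sin log log log (1 / |t|)`. -/
def wTilde (t : ℝ) : ℝ :=
  if t = 0 then 0 else t * Real.sin (Real.log (Real.log (Real.log (1 / |t|))))

/-- The translate of the basic singular function to the point `a`. -/
def wTildeAt (a t : ℝ) : ℝ := wTilde (t - a)

/-- First part of the coefficient of the weight function. -/
def psi1 (t : ℝ) : ℝ :=
  if t = 0 then 0 else 402 / (|t| * Real.log (Real.log (1 / (5 * |t|))))

/-- Second part of the coefficient of the weight function. -/
def psi2 (t : ℝ) : ℝ :=
  if t = 0 then 0 else 3 + 4 * |iteratedDeriv 2 wTilde t|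

/-- The coefficient of the weight function. -/
def psi (t : ℝ) : ℝ := psi1 t + psi2 t

/-- The constant `C = 1 + sup_{t ∈ [-T, T]} 5 |t| ψ(t)`. -/
def constC : ℝ := 1 + sSup ((fun t : ℝ => 5 * |t| * psi t) '' dom)

/-- `σ_n = min_{i < n} |x_i - x_n| / 2`; only used for `n ≥ 1`. -/
def sigma (x : ℕ → ℝ) (n : ℕ) : ℝ := (⨅ i : Fin n, |x i - x n|) / 2

/-- `ε_n = 2^{-n} (1 - e^{-1})`. -/
def eps (n : ℕ) : ℝ := (1 / 2) ^ n * (1 - Real.exp (-1))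

/-- The interval `Y_n` or `Z_n`, with centre `a` and radius `r`. -/
def ivl (a r : ℝ) : Set ℝ := Icc (a - r) (a + r)

/-! ### One step of the inductive construction

In this section `f` is the function to be modified near the point `a`, the modification takes place
on `[a - T, a + T]`, a copy of `α w̃` is inserted on `[a - τ, a + τ]`, and `0 < τ ≤ R < T / 2`. -/

/-- `c_l`. -/
def cL (f : ℝ → ℝ) (a R α τ : ℝ) : ℝ :=
  f a + α * wTildeAt a (a - τ) - deriv f a * (a - τ) - f (a - R) + deriv f a * (a - R)

/-- `c_r`. -/
def cR (f : ℝ → ℝ) (a R α τ : ℝ) : ℝ :=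
  f a + α * wTildeAt a (a + τ) - deriv f a * (a + τ) - f (a + R) + deriv f a * (a + R)

/-- `δ_l`. -/
def deltaL (f : ℝ → ℝ) (a R : ℝ) : ℝ := deriv f a - deriv f (a - R)

/-- `δ_r`. -/
def deltaR (f : ℝ → ℝ) (a R : ℝ) : ℝ := deriv f a - deriv f (a + R)

/-- `d_l`. -/
def dL (f : ℝ → ℝ) (a T R α τ : ℝ) : ℝ :=
  4 / T * (cL f a R α τ - deltaL f a R / 2 * (T / 2 - R))

/-- `d_r`. -/
def dR (f : ℝ → ℝ) (a T R α τ : ℝ) : ℝ :=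
  4 / T * (cR f a R α τ + deltaR f a R / 2 * (T / 2 - R))

/-- The continuous piecewise affine function that is `0` on `(-∞, a - T]`, `d` at `a - 3T/4`,
`0` at `a - T/2`, `δ` on `[a - R, ∞)`, and affine in between. -/
def gL (a T R d δ t : ℝ) : ℝ :=
  if t ≤ a - T then 0
  else if t ≤ a - 3 * T / 4 then d * (t - (a - T)) / (T / 4)
  else if t ≤ a - T / 2 then d * (a - T / 2 - t) / (T / 4)
  else if t ≤ a - R then δ * (t - (a - T / 2)) / (T / 2 - R)
  else δ

/-- The continuous piecewise affine function that is `δ` on `(-∞, a + R]`, `0` at `a + T/2`,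
`-d` at `a + 3T/4`, `0` on `[a + T, ∞)`, and affine in between. -/
def gR (a T R d δ t : ℝ) : ℝ :=
  if t ≤ a + R then δ
  else if t ≤ a + T / 2 then δ * (a + T / 2 - t) / (T / 2 - R)
  else if t ≤ a + 3 * T / 4 then -d * (t - (a + T / 2)) / (T / 4)
  else if t ≤ a + T then -d * (a + T - t) / (T / 4)
  else 0

/-- The cut-off function `χ_l` on the left of `a`. -/
def chiL (f : ℝ → ℝ) (a T R α τ t : ℝ) : ℝ :=
  ∫ s in (-halfLen)..t, gL a T R (dL f a T R α τ) (deltaL f a R) s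

/-- The cut-off function `χ_r` on the right of `a`. -/
def chiR (f : ℝ → ℝ) (a T R α τ t : ℝ) : ℝ :=
  cR f a R α τ - deltaR f a R * ((a + R) - (-halfLen)) +
    ∫ s in (-halfLen)..t, gR a T R (dR f a T R α τ) (deltaR f a R) s

/-- The function `f` with a copy of `α w̃` inserted near `a`. -/
def insertCopy (f : ℝ → ℝ) (a T R α τ t : ℝ) : ℝ :=
  if t ≤ a - R then f t + chiL f a T R α τ t
  else if t < a - τ then deriv f a * t + f (a - R) - deriv f a * (a - R) + cL f a R α τ
  else if t ≤ a + τ then α * wTildeAt a t + f a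
  else if t < a + R then deriv f a * t + f (a + R) - deriv f a * (a + R) + cR f a R α τ
  else f t + chiR f a T R α τ t

/-- The approximating functions `w_n` (only their values on `[-T, T]` matter): `w_0` is the
translate of `w̃` to `x_0`, and `w_n` is `w_{n-1}` with a copy of `α_n w̃` inserted near `x_n`. -/
def approx (x T R α τ : ℕ → ℝ) : ℕ → ℝ → ℝ
  | 0 => wTildeAt (x 0)
  | n + 1 =>
      insertCopy (approx x T R α τ n) (x (n + 1)) (T (n + 1)) (R (n + 1)) (α (n + 1)) (τ (n + 1))

/-- An admissible choice of the constants of the construction for the sequence `x`.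
They do not depend on the functions `w_n`. -/
structure Constants (x : ℕ → ℝ) where
  K : ℕ → ℝ
  K_zero : K 0 = 1
  K_succ : ∀ n, 1 + K n ≤ K (n + 1)
  K_bound : ∀ n, ∀ t ∈ dom, (∀ i ≤ n, sigma x (n + 1) ≤ |x i - t|) →
    2 * ∑ i ∈ Finset.range (n + 1), |iteratedDeriv 2 (wTildeAt (x i)) t| ≤ K (n + 1)
  T : ℕ → ℝ
  T_zero : T 0 = halfLen
  T_mem : ∀ n, T n ∈ Ioo (0 : ℝ) 1
  T_sub : ∀ n, ivl (x n) (T n) ⊆ dom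
  T_sigma : ∀ n, T (n + 1) < sigma x (n + 1)
  T_half : ∀ n, T (n + 1) < T n / 2
  T_psi : ∀ n, ∀ t ∈ ivl (x (n + 1)) (T (n + 1)),
    |(t - x (n + 1)) * psi (t - x (n + 1))| < (1 / 2) ^ (n + 1) / 5
  T_K : ∀ n, T (n + 1) < (K (n + 1))⁻¹
  m : ℕ → ℕ
  lt_m : ∀ n, n < m n
  m_bound : ∀ n, (1 / 2 : ℝ) ^ m n < T (n + 1) ^ 2 / 256
  G : ℕ → Set ℝ
  G_open : ∀ n, IsOpen (G n)
  G_sub : ∀ n, G n ⊆ dom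
  G_cover : ∀ n, ∀ i ≤ m n, x i ∈ G n
  G_meas : ∀ n, volume (G n) ≤ ENNReal.ofReal (T (n + 1) ^ 2 / (16 * constC))
  M : ℕ → ℝ
  one_lt_M : ∀ n, 1 < M n
  M_bound : ∀ n, ∀ t ∈ dom \ G n,
    ∑ i ∈ Finset.range (m n + 1), max (psi (t - x i)) (psi (T i)) ≤ M n
  R : ℕ → ℝ
  R_zero : R 0 = T 0
  R_mem : ∀ n, R n ∈ Ioc 0 (T n)
  R_log : ∀ n, 1 / (Real.log (Real.log (1 / R (n + 1))) * Real.log (1 / R (n + 1)))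
    < eps (n + 1) / 2
  R_half : ∀ n, R (n + 1) < R n / 2
  R_small : ∀ n, R (n + 1)
    < (1 / 2) ^ (n + 1) * T (n + 1) ^ 3 * eps (n + 1) / (128 * 25 * M n)

/-- A run of the inductive construction for the sequence `x`: a choice of the constants, and at each
step `n ≥ 1` a scaling factor `α_n` and a radius `τ_n` such that the scaled copy `α_n w̃_n` is not
too steep on `Z_n` and has at `x_n - τ_n` (and then, being odd about `x_n`, also at `x_n + τ_n`) the
slope that `w_{n-1}` has at `x_n`. -/
structure Construction (x : ℕ → ℝ) extends Constants x where
  α : ℕ → ℝ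
  τ : ℕ → ℝ
  α_mem : ∀ n, α (n + 1) ∈ Ico (1 : ℝ) 2
  α_steep : ∀ n, ∀ t ∈ ivl (x (n + 1)) (R (n + 1)) \ {x (n + 1)},
    |α (n + 1) * deriv (wTildeAt (x (n + 1))) t| < 2 - eps (n + 1)
  τ_mem : ∀ n, τ (n + 1) ∈ Ioc 0 (R (n + 1))
  τ_join : ∀ n, α (n + 1) * deriv (wTildeAt (x (n + 1))) (x (n + 1) - τ (n + 1))
    = deriv (approx x T R α τ n) (x (n + 1))

/-- The function `w_n` of a run of the construction. -/
def Construction.w {x : ℕ → ℝ} (c : Construction x) (n : ℕ) : ℝ → ℝ :=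
  approx x c.T c.R c.α c.τ n

/-- The set of the points of `(-T, T)` at which the upper Dini derivative of `u` is at least `1` and
the lower one is at most `-1`. -/
def singularSet (u : ℝ → ℝ) : Set ℝ :=
  {s | s ∈ Ioo (-halfLen) halfLen ∧
    1 ≤ upperDini (-halfLen) halfLen u s ∧ lowerDini (-halfLen) halfLen u s ≤ -1}

end SingularMinimizer

end

/-!
Each step of the construction is a small modification, and this is what makes everything work. Write
`f = w_{n-1}`, `a = x_n`, `T = T_n`, `R = R_n`, and let `q = 2^{-n} ε_n`
(`SingularMinimizer.stepSize`). On `[a - T, a + T]` the second derivative of `f` is at most `K_n + 1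
< 2 / T`, because the earlier points `x_i` are further away than `σ_n`. As `R` is at most `q T ^ 3 /
3200`, the numbers `δ_l`, `δ_r`, `c_l`, `c_r`, `d_l`, `d_r` are at most a small multiple of `q T ^
2`. Hence the slope of `f` outside `[a - R, a + R]` changes by at most `q ≤ ε_n`, its second
derivative by at most `q ≤ 2^{-n}`, and its values by at most `q T ^ 2`; outside `[a - T, a + T]`
nothing changes (`StepHyp.insertCopy_slopeBounds`, `StepHyp.abs_insertCopy_sub_le`). So the bound
`|w_n'| ≤ 2 - ε_n` away from `x_0, …, x_n` and a bound for `w_n''` are passed on from step to step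
(`StageInv.succ`). The second derivatives have jumps at the points where the pieces are joined, so
they are replaced by pointwise Lipschitz constants of the first derivative (`SlopeBounds`).

The construction can be carried out because `w̃'` runs from `-1` to `1` arbitrarily close to `0`
(`exists_wTildeDeriv_eq`), so that `α w̃'` takes the value `m = w_{n-1}'(x_n)` for `α = max 1 |m|`;
this `α` is small enough since `|m| ≤ 2 - 2 ε_n` (`StageInv.exists_stepChoice`).

The limit `w` exists since the changes are summable. Near `x_n` the function `w_n` is a copy of `α_n
w̃`, whose difference quotients at `x_n` are `α_n sin log log log (1 / |t - x_n|)` and oscillate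
between `±α_n`. A later modification, on an interval of radius `T_k` and at distance at least `T_k`
from `x_n`, has size at most `2^{-k} T_k ≤ 2^{-k} |t - x_n|`. Near `x_n` only modifications with
large `k` are felt, so they add up to `o (t - x_n)` (`Construction.exists_limit_near`), and the
oscillation survives in `w`.

The two conditions on the Dini derivatives are countable intersections of open conditions, because
`w` is continuous (`isGδ_singularSet`). A `Gδ` set that is dense in an interval is not meagre, by
Baire's theorem (`not_isMeagre_of_isGδ`).
-/

namespace SingularMinimizer

/-! ### The basic singular function -/

/-- The derivative of `wTilde` away from `0`. `Real.log t` is `log |t|`, so `-log t` is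
`log (1 / |t|)` and the formula is even in `t`. -/
noncomputable def wTildeDeriv (t : ℝ) : ℝ :=
  Real.sin (Real.log (Real.log (-Real.log t))) -
    Real.cos (Real.log (Real.log (-Real.log t))) / (-Real.log t * Real.log (-Real.log t))

/-- The second derivative of `wTilde` away from `0`. -/
noncomputable def wTildeDeriv2 (t : ℝ) : ℝ :=
  -(1 / t) *
    (Real.cos (Real.log (Real.log (-Real.log t))) / (-Real.log t * Real.log (-Real.log t)) +
      (Real.sin (Real.log (Real.log (-Real.log t))) +
        Real.cos (Real.log (Real.log (-Real.log t))) * (Real.log (-Real.log t) + 1)) /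
        (-Real.log t * Real.log (-Real.log t)) ^ 2)

lemma wTilde_eq (t : ℝ) : wTilde t = t * Real.sin (Real.log (Real.log (-Real.log t))) := by
  unfold wTilde
  split_ifs with h
  · simp [h]
  · rw [one_div, Real.log_inv, Real.log_abs]

@[simp] lemma wTilde_zero : wTilde 0 = 0 := by simp [wTilde]

lemma abs_wTilde_le (t : ℝ) : |wTilde t| ≤ |t| := by
  rw [wTilde_eq, abs_mul]
  exact mul_le_of_le_one_right (abs_nonneg _) (Real.abs_sin_le_one _)

lemma wTildeDeriv_neg (t : ℝ) : wTildeDeriv (-t) = wTildeDeriv t := by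
  simp [wTildeDeriv, Real.log_neg_eq_log]

lemma ne_zero_of_one_lt_neg_log {t : ℝ} (h : 1 < -Real.log t) : t ≠ 0 := by
  rintro rfl; norm_num at h

lemma hasDerivAt_neg_log {t : ℝ} (h : t ≠ 0) :
    HasDerivAt (fun t => -Real.log t) (-(1 / t)) t :=
  (Real.hasDerivAt_log h).neg.congr_deriv (by simp)

lemma hasDerivAt_log_neg_log {t : ℝ} (h : 1 < -Real.log t) :
    HasDerivAt (fun t => Real.log (-Real.log t)) (-(1 / t) / -Real.log t) t :=
  (hasDerivAt_neg_log (ne_zero_of_one_lt_neg_log h)).log (by linarith)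

lemma hasDerivAt_log_log_neg_log {t : ℝ} (h : 1 < -Real.log t) :
    HasDerivAt (fun t => Real.log (Real.log (-Real.log t)))
      (-(1 / t) / -Real.log t / Real.log (-Real.log t)) t :=
  (hasDerivAt_log_neg_log h).log (Real.log_pos h).ne'

lemma hasDerivAt_wTilde {t : ℝ} (h : 1 < -Real.log t) :
    HasDerivAt wTilde (wTildeDeriv t) t := by
  have h0 := ne_zero_of_one_lt_neg_log h
  have h2 := (Real.log_pos h).ne'
  have h1 : -Real.log t ≠ 0 := by linarith
  have := (hasDerivAt_id t).mul (hasDerivAt_log_log_neg_log h).sin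
  refine (this.congr_deriv ?_).congr_of_eventuallyEq (Eventually.of_forall fun s => wTilde_eq s)
  unfold wTildeDeriv
  simp only [id]
  generalize Real.log (-Real.log t) = b at *
  generalize -Real.log t = a at *
  field_simp
  ring

lemma hasDerivAt_wTildeDeriv {t : ℝ} (h : 1 < -Real.log t) :
    HasDerivAt wTildeDeriv (wTildeDeriv2 t) t := by
  have h0 := ne_zero_of_one_lt_neg_log h
  have h2 := (Real.log_pos h).ne'
  have h1 : -Real.log t ≠ 0 := by linarith
  have := (hasDerivAt_log_log_neg_log h).sin.sub ((hasDerivAt_log_log_neg_log h).cos.div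
    ((hasDerivAt_neg_log h0).mul (hasDerivAt_log_neg_log h)) (mul_ne_zero h1 h2))
  refine this.congr_deriv ?_
  unfold wTildeDeriv2
  simp only [Pi.mul_apply]
  generalize Real.log (-Real.log t) = b at *
  generalize -Real.log t = a at *
  field_simp
  ring

lemma eventually_one_lt_neg_log {t : ℝ} (h : 1 < -Real.log t) :
    ∀ᶠ s in 𝓝 t, 1 < -Real.log s :=
  (hasDerivAt_neg_log (ne_zero_of_one_lt_neg_log h)).continuousAt.eventually (lt_mem_nhds h)

lemma iteratedDeriv_two_wTilde {t : ℝ} (h : 1 < -Real.log t) :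
    iteratedDeriv 2 wTilde t = wTildeDeriv2 t := by
  rw [iteratedDeriv_succ, iteratedDeriv_one]
  have : deriv wTilde =ᶠ[𝓝 t] wTildeDeriv := by
    filter_upwards [eventually_one_lt_neg_log h] with s hs using (hasDerivAt_wTilde hs).deriv
  rw [this.deriv_eq, (hasDerivAt_wTildeDeriv h).deriv]

lemma iteratedDeriv_two_wTildeAt (a t : ℝ) :
    iteratedDeriv 2 (wTildeAt a) t = iteratedDeriv 2 wTilde (t - a) :=
  congrFun (iteratedDeriv_comp_sub_const 2 wTilde a) t

lemma deriv_wTildeAt {a t : ℝ} (h : 1 < -Real.log (t - a)) :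
    deriv (wTildeAt a) t = wTildeDeriv (t - a) :=
  ((hasDerivAt_wTilde h).comp_sub_const t a).deriv

lemma halfLen_pos : 0 < halfLen := by unfold halfLen; positivity

lemma halfLen_lt_half : halfLen < 1 / 2 := by
  have : Real.exp (-Real.exp 1) < 1 := by
    rw [Real.exp_lt_one_iff]; simp [Real.exp_pos]
  unfold halfLen; linarith

lemma exp_one_lt_neg_log {t : ℝ} (h0 : t ≠ 0) (ht : |t| < 2 * halfLen) :
    Real.exp 1 < -Real.log t := by
  have h : |t| < Real.exp (-Real.exp 1) := by unfold halfLen at ht; linarith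
  have := Real.log_lt_log (abs_pos.2 h0) h
  rw [Real.log_exp, Real.log_abs] at this
  linarith

lemma one_lt_neg_log {t : ℝ} (h0 : t ≠ 0) (ht : |t| < 2 * halfLen) : 1 < -Real.log t :=
  (Real.one_lt_exp_iff.2 one_pos).trans (exp_one_lt_neg_log h0 ht)

lemma one_lt_log_neg_log {t : ℝ} (h0 : t ≠ 0) (ht : |t| < 2 * halfLen) :
    1 < Real.log (-Real.log t) := by
  rw [Real.lt_log_iff_exp_lt (by linarith [one_lt_neg_log h0 ht])]
  exact exp_one_lt_neg_log h0 ht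

lemma abs_wTildeDeriv_le {t : ℝ} (h0 : t ≠ 0) (ht : |t| < 2 * halfLen) :
    |wTildeDeriv t| ≤ 1 + 1 / (-Real.log t * Real.log (-Real.log t)) := by
  have h1 := one_lt_neg_log h0 ht
  have h2 := one_lt_log_neg_log h0 ht
  unfold wTildeDeriv
  refine (abs_sub _ _).trans (add_le_add (Real.abs_sin_le_one _) ?_)
  have hP : 0 < -Real.log t * Real.log (-Real.log t) := by nlinarith
  rw [abs_div, abs_of_pos hP]
  gcongr
  exact Real.abs_cos_le_one _

lemma continuousAt_wTilde_zero : ContinuousAt wTilde 0 := by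
  rw [ContinuousAt, wTilde_zero]
  exact squeeze_zero_norm abs_wTilde_le (by simpa using (continuous_abs.tendsto (0 : ℝ)))

lemma tendsto_neg_log : Tendsto (fun t => -Real.log t) (𝓝[≠] 0) atTop :=
  tendsto_neg_atBot_atTop.comp Real.tendsto_log_nhdsNE_zero

lemma tendsto_neg_log_mul_log :
    Tendsto (fun t => -Real.log t * Real.log (-Real.log t)) (𝓝[≠] 0) atTop :=
  tendsto_neg_log.atTop_mul_atTop₀ (Real.tendsto_log_atTop.comp tendsto_neg_log)

lemma eventually_abs_lt_nhdsNE {r : ℝ} (hr : 0 < r) : ∀ᶠ t in 𝓝[≠] (0 : ℝ), t ≠ 0 ∧ |t| < r := by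
  refine (eventually_mem_nhdsWithin).and (eventually_nhdsWithin_of_eventually_nhds ?_)
  have := (continuous_abs.tendsto (0 : ℝ)).eventually (gt_mem_nhds (by simpa using hr))
  exact this

/-- This is what makes the weight function `psi` satisfy `t * psi t → 0`. -/
lemma tendsto_mul_wTildeDeriv2 :
    Tendsto (fun t => |t| * |wTildeDeriv2 t|) (𝓝[≠] 0) (𝓝 0) := by
  have hlim : Tendsto (fun t => 4 * (-Real.log t * Real.log (-Real.log t))⁻¹) (𝓝[≠] 0) (𝓝 0) := by
    simpa using (tendsto_inv_atTop_zero.comp tendsto_neg_log_mul_log).const_mul 4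
  refine squeeze_zero' (Eventually.of_forall fun t => by positivity) ?_ hlim
  filter_upwards [eventually_abs_lt_nhdsNE (mul_pos two_pos halfLen_pos)] with t ⟨h0, ht⟩
  have h1 := one_lt_neg_log h0 ht
  have h2 := one_lt_log_neg_log h0 ht
  unfold wTildeDeriv2
  have hs := Real.abs_sin_le_one (Real.log (Real.log (-Real.log t)))
  have hc := Real.abs_cos_le_one (Real.log (Real.log (-Real.log t)))
  set c := Real.cos (Real.log (Real.log (-Real.log t)))
  set s := Real.sin (Real.log (Real.log (-Real.log t)))
  set b := Real.log (-Real.log t)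
  set a := -Real.log t
  rw [← abs_mul, ← mul_assoc, abs_mul, show |t * -(1 / t)| = 1 by
    rw [mul_neg, mul_one_div_cancel h0]; simp, one_mul]
  have hab : 1 < a * b := by nlinarith
  have hP : (0 : ℝ) < a * b := by linarith
  calc _ ≤ |c / (a * b)| + |(s + c * (b + 1)) / (a * b) ^ 2| := abs_add_le _ _
    _ ≤ 1 / (a * b) + (1 + 1 * (b + 1)) / (a * b) ^ 2 := by
      rw [abs_div, abs_div, abs_of_pos hP, abs_of_pos (pow_pos hP 2)]
      gcongr
      refine (abs_add_le _ _).trans (add_le_add hs ?_)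
      rw [abs_mul, abs_of_pos (show 0 < b + 1 by linarith)]
      gcongr
    _ ≤ 4 * (a * b)⁻¹ := by
      have : (1 + 1 * (b + 1)) / (a * b) ^ 2 ≤ 3 * (a * b) / (a * b) ^ 2 := by
        gcongr; nlinarith
      rw [show 3 * (a * b) / (a * b) ^ 2 = 3 * (a * b)⁻¹ by field_simp] at this
      rw [one_div]; linarith

/-- The points at which `log log log (1 / t)` takes the value `y`. -/
noncomputable def tripleExp (y : ℝ) : ℝ := Real.exp (-Real.exp (Real.exp y))

lemma tripleExp_pos (y : ℝ) : 0 < tripleExp y := Real.exp_pos _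

lemma wTilde_tripleExp (y : ℝ) : wTilde (tripleExp y) = tripleExp y * Real.sin y := by
  simp [wTilde_eq, tripleExp]

lemma wTildeDeriv_tripleExp (y : ℝ) : wTildeDeriv (tripleExp y) =
    Real.sin y - Real.cos y / (Real.exp (Real.exp y) * Real.exp y) := by
  simp [wTildeDeriv, tripleExp]

lemma tendsto_tripleExp : Tendsto tripleExp atTop (𝓝 0) :=
  Real.tendsto_exp_atBot.comp (tendsto_neg_atTop_atBot.comp
    (Real.tendsto_exp_atTop.comp Real.tendsto_exp_atTop))

/-- Arbitrarily close to `0` the derivative of `wTilde` runs from `-1` to `1`. -/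
lemma exists_wTildeDeriv_eq {r v : ℝ} (hr : 0 < r) (hv : |v| ≤ 1) :
    ∃ τ ∈ Ioc 0 r, wTildeDeriv τ = v := by
  obtain ⟨Y, hY⟩ := (tendsto_tripleExp.eventually (gt_mem_nhds hr)).exists_forall_of_atTop
  obtain ⟨k, hk⟩ := exists_nat_gt ((Y + Real.pi / 2) / (2 * Real.pi))
  rw [div_lt_iff₀ (by positivity)] at hk
  have hcont : Continuous fun y => wTildeDeriv (tripleExp y) := by
    simp_rw [wTildeDeriv_tripleExp]
    have : ∀ y : ℝ, Real.exp (Real.exp y) * Real.exp y ≠ 0 := fun y => by positivity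
    fun_prop (disch := assumption)
  have hle : -(Real.pi / 2) + k * (2 * Real.pi) ≤ Real.pi / 2 + k * (2 * Real.pi) := by
    linarith [Real.pi_pos]
  have h := intermediate_value_Icc hle hcont.continuousOn
  have hlo : wTildeDeriv (tripleExp (-(Real.pi / 2) + k * (2 * Real.pi))) = -1 := by
    rw [wTildeDeriv_tripleExp, Real.sin_add_nat_mul_two_pi, Real.cos_add_nat_mul_two_pi]; simp
  have hhi : wTildeDeriv (tripleExp (Real.pi / 2 + k * (2 * Real.pi))) = 1 := by
    rw [wTildeDeriv_tripleExp, Real.sin_add_nat_mul_two_pi, Real.cos_add_nat_mul_two_pi]; simp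
  simp only [hlo, hhi] at h
  obtain ⟨y, hy, hyv⟩ := h (abs_le.1 hv)
  exact ⟨tripleExp y, ⟨tripleExp_pos y, (hY y (by linarith [hy.1])).le⟩, hyv⟩

/-! ### Gluing functions along a point -/

/-- The function that is `u` up to and including `p`, and `v` beyond `p`. -/
noncomputable def glue (p : ℝ) (u v : ℝ → ℝ) (t : ℝ) : ℝ := if t ≤ p then u t else v t

lemma glue_of_le {p t : ℝ} {u v : ℝ → ℝ} (h : t ≤ p) : glue p u v t = u t := if_pos h

lemma glue_of_ge {p t : ℝ} {u v : ℝ → ℝ} (hp : u p = v p) (h : p ≤ t) : glue p u v t = v t := by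
  rcases h.eq_or_lt with rfl | h
  · rw [glue_of_le le_rfl, hp]
  · exact if_neg h.not_ge

/-- The function `u` has derivative `F t` at `t`, bounded by `ρ`, and `F` is Lipschitz at `t` with
every constant larger than `κ`. This stands for `|u'(t)| ≤ ρ` and `|u''(t)| ≤ κ`, and it makes sense
where `u''` has a jump. -/
def SlopeBounds (u F : ℝ → ℝ) (ρ κ t : ℝ) : Prop :=
  HasDerivAt u (F t) t ∧ |F t| ≤ ρ ∧ ∀ B > κ, ∀ᶠ s in 𝓝 t, |F s - F t| ≤ B * |s - t|

lemma SlopeBounds.mono {u F : ℝ → ℝ} {ρ κ ρ' κ' t : ℝ} (h : SlopeBounds u F ρ κ t) (hρ : ρ ≤ ρ')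
    (hκ : κ ≤ κ') : SlopeBounds u F ρ' κ' t :=
  ⟨h.1, h.2.1.trans hρ, fun B hB => h.2.2 B (hκ.trans_lt hB)⟩

lemma SlopeBounds.add {u v F G : ℝ → ℝ} {ρ κ ρ' κ' t : ℝ} (h : SlopeBounds u F ρ κ t)
    (h' : SlopeBounds v G ρ' κ' t) :
    SlopeBounds (fun t => u t + v t) (fun t => F t + G t) (ρ + ρ') (κ + κ') t := by
  refine ⟨h.1.add h'.1, (abs_add_le _ _).trans (add_le_add h.2.1 h'.2.1), fun B hB => ?_⟩
  filter_upwards [h.2.2 (κ + (B - (κ + κ')) / 2) (by linarith),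
    h'.2.2 (κ' + (B - (κ + κ')) / 2) (by linarith)] with s h1 h2
  calc |F s + G s - (F t + G t)| = |(F s - F t) + (G s - G t)| := by ring_nf
    _ ≤ _ := abs_add_le _ _
    _ ≤ _ := add_le_add h1 h2
    _ = B * |s - t| := by ring

lemma slopeBounds_affine (m k ρ t : ℝ) (hm : |m| ≤ ρ) {κ : ℝ} (hκ : 0 ≤ κ) :
    SlopeBounds (fun t => m * t + k) (fun _ => m) ρ κ t := by
  refine ⟨by simpa using ((hasDerivAt_id t).const_mul m).add_const k, hm, fun B hB => ?_⟩
  have : 0 < B := hκ.trans_lt hB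
  exact Eventually.of_forall fun s => by simp only [sub_self, abs_zero]; positivity

lemma SlopeBounds.of_hasDerivAt {u F : ℝ → ℝ} {t S ρ κ : ℝ} (hu : HasDerivAt u (F t) t)
    (hF : HasDerivAt F S t) (hρ : |F t| ≤ ρ) (hκ : |S| ≤ κ) : SlopeBounds u F ρ κ t := by
  refine ⟨hu, hρ, fun B hB => ?_⟩
  have := hF.isLittleO.def (show 0 < B - |S| by linarith)
  filter_upwards [this] with s hs
  simp only [Real.norm_eq_abs, smul_eq_mul] at hs
  calc |F s - F t| = |(F s - F t - (s - t) * S) + (s - t) * S| := by ring_nf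
    _ ≤ |F s - F t - (s - t) * S| + |(s - t) * S| := abs_add_le _ _
    _ ≤ (B - |S|) * |s - t| + |s - t| * |S| := by rw [abs_mul]; gcongr
    _ = B * |s - t| := by ring

lemma SlopeBounds.glue {u v F G : ℝ → ℝ} {p t ρ κ : ℝ} (hu : t ≤ p → SlopeBounds u F ρ κ t)
    (hv : p ≤ t → SlopeBounds v G ρ κ t) (huv : u p = v p) (hFG : F p = G p) :
    SlopeBounds (glue p u v) (glue p F G) ρ κ t := by
  rcases lt_trichotomy t p with h | rfl | h
  · obtain ⟨h1, h2, h3⟩ := hu h.le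
    have key : ∀ a b : ℝ → ℝ, SingularMinimizer.glue p a b =ᶠ[𝓝 t] a := fun a b => by
      filter_upwards [gt_mem_nhds h] with s hs using glue_of_le (le_of_lt hs)
    refine ⟨?_, ?_, fun B hB => ?_⟩
    · rw [(key F G).eq_of_nhds]; exact h1.congr_of_eventuallyEq (key u v)
    · rwa [(key F G).eq_of_nhds]
    · filter_upwards [h3 B hB, key F G] with s hs hs'
      rwa [(key F G).eq_of_nhds, hs']
  · obtain ⟨h1, h2, h3⟩ := hu le_rfl
    obtain ⟨k1, k2, k3⟩ := hv le_rfl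
    have e : SingularMinimizer.glue t F G t = F t := glue_of_le le_rfl
    refine ⟨?_, by rwa [e], fun B hB => ?_⟩
    · rw [e]
      have a1 : HasDerivWithinAt (SingularMinimizer.glue t u v) (F t) (Iic t) t :=
        h1.hasDerivWithinAt.congr (fun s hs => glue_of_le hs) (glue_of_le le_rfl)
      have a2 : HasDerivWithinAt (SingularMinimizer.glue t u v) (F t) (Ici t) t := by
        rw [hFG]
        exact k1.hasDerivWithinAt.congr (fun s hs => glue_of_ge huv hs) (glue_of_ge huv le_rfl)
      have := a1.union a2
      rwa [Iic_union_Ici, hasDerivWithinAt_univ] at this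
    · filter_upwards [h3 B hB, k3 B hB] with s hs hs'
      rw [e]
      rcases le_total s t with h | h
      · rwa [glue_of_le h]
      · rwa [glue_of_ge hFG h, hFG]
  · obtain ⟨h1, h2, h3⟩ := hv h.le
    have key : ∀ a b : ℝ → ℝ, SingularMinimizer.glue p a b =ᶠ[𝓝 t] b := fun a b => by
      filter_upwards [lt_mem_nhds h] with s hs using if_neg (not_le.2 hs)
    refine ⟨?_, ?_, fun B hB => ?_⟩
    · rw [(key F G).eq_of_nhds]; exact h1.congr_of_eventuallyEq (key u v)
    · rwa [(key F G).eq_of_nhds]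
    · filter_upwards [h3 B hB, key F G] with s hs hs'
      rwa [(key F G).eq_of_nhds, hs']

/-- Pointwise second-order bounds integrate to a Lipschitz bound for the derivative. -/
lemma abs_sub_le_of_slopeBounds {u F : ℝ → ℝ} {ρ κ a b : ℝ} (hab : a ≤ b)
    (h : ∀ t ∈ Icc a b, SlopeBounds u F ρ κ t) : |F b - F a| ≤ κ * (b - a) := by
  have hcont : ∀ t ∈ Icc a b, ContinuousAt F t := fun t ht => by
    refine tendsto_iff_norm_sub_tendsto_zero.2
      (squeeze_zero' (Eventually.of_forall fun _ => norm_nonneg _)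
        ((h t ht).2.2 (κ + 1) (by linarith)) ?_)
    have : ContinuousAt (fun s => (κ + 1) * |s - t|) t := by fun_prop
    simpa [ContinuousAt] using this
  have main : ∀ B > κ, |F b - F a| ≤ B * (b - a) := fun B hB => by
    refine image_norm_le_of_liminf_right_slope_norm_lt_deriv_boundary
      (f := fun t => F t - F a) (a := a) (b := b) (f' := fun _ => κ) (B := fun t => B * (t - a))
      (B' := fun _ => B) (fun t ht => ((hcont t ht).sub continuousAt_const).continuousWithinAt)
      (fun t ht r hr => ?_) (by simp) (by fun_prop) (fun t _ => ?_) (fun _ _ _ => hB)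
      (right_mem_Icc.2 hab)
    · refine Eventually.frequently ?_
      filter_upwards [nhdsWithin_le_nhds ((h t (Ico_subset_Icc_self ht)).2.2 ((κ + r) / 2)
        (by linarith)), self_mem_nhdsWithin] with s hs hts
      have hts' : 0 < s - t := sub_pos.2 hts
      rw [slope_def_field, div_lt_iff₀ hts']
      rw [abs_of_pos hts'] at hs
      simp only [Function.comp, Real.norm_eq_abs]
      have := abs_sub_abs_le_abs_sub (F s - F a) (F t - F a)
      rw [sub_sub_sub_cancel_right] at this
      nlinarith
    · simpa using (((hasDerivAt_id t).sub_const a).const_mul B).hasDerivWithinAt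
  rcases hab.eq_or_lt with rfl | hab
  · simp
  refine le_of_forall_pos_le_add fun e he => ?_
  have := main (κ + e / (b - a)) (by have := div_pos he (sub_pos.2 hab); linarith)
  rwa [add_mul, div_mul_cancel₀ _ (sub_pos.2 hab).ne'] at this

/-- The mean value inequality for functions with slope bounds. -/
lemma abs_sub_le_of_slope_le {u F : ℝ → ℝ} {ρ κ a b : ℝ} (hab : a ≤ b)
    (h : ∀ t ∈ Icc a b, SlopeBounds u F ρ κ t) : |u b - u a| ≤ ρ * (b - a) := by
  have := (convex_Icc a b).norm_image_sub_le_of_norm_hasDerivWithin_le (C := ρ)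
    (fun t ht => (h t ht).1.hasDerivWithinAt) (fun t ht => (h t ht).2.1)
    (left_mem_Icc.2 hab) (right_mem_Icc.2 hab)
  simpa [abs_of_nonneg (sub_nonneg.2 hab)] using this

lemma glue_lipschitz {u v : ℝ → ℝ} {p L : ℝ} (hu : ∀ s t, |u s - u t| ≤ L * |s - t|)
    (hv : ∀ s t, |v s - v t| ≤ L * |s - t|) (huv : u p = v p) (s t : ℝ) :
    |glue p u v s - glue p u v t| ≤ L * |s - t| := by
  have key : ∀ s t, s ≤ p → p ≤ t → |u s - v t| ≤ L * |s - t| := fun s t hs ht => by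
    have h1 := hu s p
    have h2 := hv p t
    rw [abs_of_nonpos (by linarith : s - p ≤ 0)] at h1
    rw [abs_of_nonpos (by linarith : p - t ≤ 0)] at h2
    rw [abs_of_nonpos (by linarith : s - t ≤ 0)]
    calc |u s - v t| = |(u s - u p) + (v p - v t)| := by rw [huv]; ring_nf
      _ ≤ _ := abs_add_le _ _
      _ ≤ L * -(s - t) := by linarith
  rcases le_total s p with hs | hs <;> rcases le_total t p with ht | ht
  · simpa [glue_of_le, hs, ht] using hu s t
  · simpa [glue_of_le, glue_of_ge huv, hs, ht] using key s t hs ht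
  · rw [abs_sub_comm, abs_sub_comm s t]
    simpa [glue_of_le, glue_of_ge huv, hs, ht] using key t s ht hs
  · simpa [glue_of_ge huv, hs, ht] using hv s t

/-! ### The cut-off functions -/

lemma affine_lipschitz (c k d : ℝ) {L : ℝ} (hd : d ≠ 0) (h : |c / d| ≤ L) (s t : ℝ) :
    |c * (s - k) / d - c * (t - k) / d| ≤ L * |s - t| := by
  rw [show c * (s - k) / d - c * (t - k) / d = c / d * (s - t) by field_simp; ring, abs_mul]
  gcongr

lemma affine_lipschitz' (c k d : ℝ) {L : ℝ} (hd : d ≠ 0) (h : |c / d| ≤ L) (s t : ℝ) :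
    |c * (k - s) / d - c * (k - t) / d| ≤ L * |s - t| := by
  rw [show c * (k - s) / d - c * (k - t) / d = -(c / d * (s - t)) by field_simp; ring, abs_neg,
    abs_mul]
  gcongr

lemma const_lipschitz (c : ℝ) {L : ℝ} (hL : 0 ≤ L) (s t : ℝ) : |c - c| ≤ L * |s - t| := by
  simp only [sub_self, abs_zero]; positivity

section

variable {a T R d δ L η t : ℝ}

lemma gL_lipschitz (hT : 0 < T) (hR : R < T / 2) (hd : |d / (T / 4)| ≤ L)
    (hδ : |δ / (T / 2 - R)| ≤ L) (s t : ℝ) :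
    |gL a T R d δ s - gL a T R d δ t| ≤ L * |s - t| := by
  have hL : 0 ≤ L := (abs_nonneg _).trans hd
  have hT' : T / 4 ≠ 0 := by positivity
  have hR' : T / 2 - R ≠ 0 := by linarith
  have h1 : a - 3 * T / 4 ≤ a - T / 2 := by linarith
  have h2 : a - T / 2 ≤ a - R := by linarith
  refine glue_lipschitz (u := fun _ => 0) (const_lipschitz 0 hL)
    (glue_lipschitz (affine_lipschitz d (a - T) _ hT' hd)
      (glue_lipschitz (affine_lipschitz' d (a - T / 2) _ hT' hd)
        (glue_lipschitz (affine_lipschitz δ (a - T / 2) _ hR' hδ) (v := fun _ => δ)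
          (const_lipschitz δ hL) ?_) ?_) ?_) ?_ s t
  · have : a - R - (a - T / 2) = T / 2 - R := by ring
    simp only [this]
    exact mul_div_cancel_right₀ δ hR'
  · rw [glue_of_le h2]; simp
  · rw [glue_of_le h1]; ring
  · rw [glue_of_le (by linarith)]; simp

lemma gR_lipschitz (hT : 0 < T) (hR : R < T / 2) (hd : |d / (T / 4)| ≤ L)
    (hδ : |δ / (T / 2 - R)| ≤ L) (s t : ℝ) :
    |gR a T R d δ s - gR a T R d δ t| ≤ L * |s - t| := by
  have hL : 0 ≤ L := (abs_nonneg _).trans hd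
  have hT' : T / 4 ≠ 0 := by positivity
  have hR' : T / 2 - R ≠ 0 := by linarith
  have hR2 : T - 2 * R ≠ 0 := by linarith
  have hd' : |-d / (T / 4)| ≤ L := by rwa [neg_div, abs_neg]
  refine glue_lipschitz (u := fun _ => δ) (const_lipschitz δ hL)
    (glue_lipschitz (affine_lipschitz' δ (a + T / 2) _ hR' hδ)
      (glue_lipschitz (affine_lipschitz (-d) (a + T / 2) _ hT' hd')
        (glue_lipschitz (affine_lipschitz' (-d) (a + T) _ hT' hd') (v := fun _ => 0)
          (const_lipschitz 0 hL) ?_) ?_) ?_) ?_ s t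
  · simp
  · rw [glue_of_le (by linarith)]; ring
  · rw [glue_of_le (by linarith)]; simp
  · rw [glue_of_le (by linarith)]; field_simp; ring

lemma abs_mul_div_le {c x y : ℝ} (hc : |c| ≤ η) (hx : 0 ≤ x) (hxy : x ≤ y) : |c * x / y| ≤ η := by
  rw [mul_div_assoc, abs_mul]
  have h : |x / y| ≤ 1 := by
    rw [abs_of_nonneg (div_nonneg hx (hx.trans hxy))]
    exact div_le_one_of_le₀ hxy (hx.trans hxy)
  exact (mul_le_of_le_one_right (abs_nonneg _) h).trans hc

lemma abs_gL_le (hd : |d| ≤ η) (hδ : |δ| ≤ η) (t : ℝ) : |gL a T R d δ t| ≤ η := by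
  unfold gL
  split_ifs
  · simpa using (abs_nonneg _).trans hd
  · exact abs_mul_div_le hd (by linarith) (by linarith)
  · exact abs_mul_div_le hd (by linarith) (by linarith)
  · exact abs_mul_div_le hδ (by linarith) (by linarith)
  · exact hδ

lemma abs_gR_le (hd : |d| ≤ η) (hδ : |δ| ≤ η) (t : ℝ) : |gR a T R d δ t| ≤ η := by
  have hd' : |-d| ≤ η := by rwa [abs_neg]
  unfold gR
  split_ifs
  · exact hδ
  · exact abs_mul_div_le hδ (by linarith) (by linarith)
  · exact abs_mul_div_le hd' (by linarith) (by linarith)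
  · exact abs_mul_div_le hd' (by linarith) (by linarith)
  · simpa using (abs_nonneg _).trans hd

lemma continuous_of_lipschitz {g : ℝ → ℝ} (h : ∀ s t, |g s - g t| ≤ L * |s - t|) :
    Continuous g := by
  refine LipschitzWith.continuous (K := L.toNNReal) (LipschitzWith.of_dist_le_mul fun s t => ?_)
  rw [Real.dist_eq, Real.dist_eq]
  exact (h s t).trans (by gcongr; exact Real.le_coe_toNNReal L)

lemma continuous_gL (hT : 0 < T) (hR : R < T / 2) : Continuous (gL a T R d δ) :=
  continuous_of_lipschitz (gL_lipschitz hT hR (le_max_left _ _) (le_max_right _ _))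

lemma continuous_gR (hT : 0 < T) (hR : R < T / 2) : Continuous (gR a T R d δ) :=
  continuous_of_lipschitz (gR_lipschitz hT hR (le_max_left _ _) (le_max_right _ _))

lemma slopeBounds_integral {g : ℝ → ℝ} (hg : ∀ s t, |g s - g t| ≤ L * |s - t|)
    (hη : ∀ t, |g t| ≤ η) (b k t : ℝ) :
    SlopeBounds (fun t => k + ∫ s in b..t, g s) g η L t := by
  have hc := continuous_of_lipschitz hg
  refine ⟨(hc.integral_hasStrictDerivAt b t).hasDerivAt.const_add k, hη t, fun B hB =>
    Eventually.of_forall fun s => (hg s t).trans (by gcongr)⟩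

lemma integral_affine (c k p q : ℝ) :
    ∫ s in p..q, c * (s - k) = c / 2 * ((q - k) ^ 2 - (p - k) ^ 2) := by
  rw [intervalIntegral.integral_const_mul, intervalIntegral.integral_comp_sub_right (fun x => x),
    integral_id]
  ring

lemma integral_add_three {g : ℝ → ℝ} (hg : Continuous g) (p q r s : ℝ) :
    ∫ x in p..s, g x = (∫ x in p..q, g x) + (∫ x in q..r, g x) + ∫ x in r..s, g x := by
  have hi := fun a b => hg.intervalIntegrable (μ := volume) a b
  rw [intervalIntegral.integral_add_adjacent_intervals (hi _ _) (hi _ _),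
    intervalIntegral.integral_add_adjacent_intervals (hi _ _) (hi _ _)]

lemma integral_gL_eq_zero {p q : ℝ} (hp : p ≤ a - T) (hq : q ≤ a - T) :
    ∫ s in p..q, gL a T R d δ s = 0 := by
  refine intervalIntegral.integral_zero_ae (Eventually.of_forall fun s hs => ?_)
  exact if_pos (hs.2.trans (max_le hp hq))

lemma integral_gL (hT : 0 < T) (hR : R < T / 2) :
    ∫ s in (a - T)..(a - R), gL a T R d δ s = d * T / 4 + δ / 2 * (T / 2 - R) := by
  have hT' : T / 4 ≠ 0 := by positivity
  have hR' : T / 2 - R ≠ 0 := by linarith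
  have hR2 : T - 2 * R ≠ 0 := by linarith
  have e1 : ∫ s in (a - T)..(a - 3 * T / 4), gL a T R d δ s =
      ∫ s in (a - T)..(a - 3 * T / 4), d / (T / 4) * (s - (a - T)) := by
    refine intervalIntegral.integral_congr fun s hs => ?_
    rw [uIcc_of_le (by linarith)] at hs
    simp only [gL, hs.2, if_true]
    split_ifs with h
    · rw [le_antisymm h hs.1]; simp
    · ring
  have e2 : ∫ s in (a - 3 * T / 4)..(a - T / 2), gL a T R d δ s =
      ∫ s in (a - 3 * T / 4)..(a - T / 2), -(d / (T / 4)) * (s - (a - T / 2)) := by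
    refine intervalIntegral.integral_congr fun s hs => ?_
    rw [uIcc_of_le (by linarith)] at hs
    have h0 : ¬ s ≤ a - T := by linarith [hs.1]
    simp only [gL, hs.2, h0, if_true, if_false]
    split_ifs with h
    · rw [le_antisymm h hs.1]; ring
    · ring
  have e3 : ∫ s in (a - T / 2)..(a - R), gL a T R d δ s =
      ∫ s in (a - T / 2)..(a - R), δ / (T / 2 - R) * (s - (a - T / 2)) := by
    refine intervalIntegral.integral_congr fun s hs => ?_
    rw [uIcc_of_le (by linarith)] at hs
    have h0 : ¬ s ≤ a - T := by linarith [hs.1]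
    have h1 : ¬ s ≤ a - 3 * T / 4 := by linarith [hs.1]
    simp only [gL, hs.2, h0, h1, if_true, if_false]
    split_ifs with h
    · rw [le_antisymm h hs.1]; simp
    · ring
  rw [integral_add_three (continuous_gL hT hR) _ (a - 3 * T / 4) (a - T / 2), e1, e2, e3,
    integral_affine, integral_affine, integral_affine]
  field_simp
  ring

lemma abs_integral_gL_le (hd : |d| ≤ η) (hδ : |δ| ≤ η) (h1 : a - T ≤ t) (h2 : t ≤ a) :
    |∫ s in (a - T)..t, gL a T R d δ s| ≤ η * T := by
  have h0 : 0 ≤ η := (abs_nonneg _).trans hd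
  refine (intervalIntegral.norm_integral_le_of_norm_le_const (f := gL a T R d δ) (a := a - T)
    (b := t) (C := η) fun s _ => abs_gL_le hd hδ s).trans ?_
  rw [abs_of_nonneg (by linarith)]
  gcongr
  linarith

lemma integral_gR_eq {p q : ℝ} (hp : p ≤ a + R) (hq : q ≤ a + R) :
    ∫ s in p..q, gR a T R d δ s = δ * (q - p) := by
  have : ∫ s in p..q, gR a T R d δ s = ∫ s in p..q, δ := by
    refine intervalIntegral.integral_congr fun s hs => ?_
    exact if_pos (hs.2.trans (max_le hp hq))
  rw [this]; simp [mul_comm]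

lemma integral_gR_eq_zero (hT : 0 < T) (hR : R < T / 2) (ht : a + T ≤ t) :
    ∫ s in (a + T)..t, gR a T R d δ s = 0 := by
  refine intervalIntegral.integral_zero_ae (Eventually.of_forall fun s hs => ?_)
  rw [uIoc_of_le ht] at hs
  have h := hs.1
  unfold gR
  rw [if_neg (by linarith), if_neg (by linarith), if_neg (by linarith), if_neg (by linarith)]

lemma integral_gR (hT : 0 < T) (hR : R < T / 2) :
    ∫ s in (a + R)..(a + T), gR a T R d δ s = δ / 2 * (T / 2 - R) - d * T / 4 := by
  have hT' : T / 4 ≠ 0 := by positivity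
  have hR' : T / 2 - R ≠ 0 := by linarith
  have hR2 : T - 2 * R ≠ 0 := by linarith
  have e1 : ∫ s in (a + R)..(a + T / 2), gR a T R d δ s =
      ∫ s in (a + R)..(a + T / 2), -(δ / (T / 2 - R)) * (s - (a + T / 2)) := by
    refine intervalIntegral.integral_congr fun s hs => ?_
    rw [uIcc_of_le (by linarith)] at hs
    simp only [gR, hs.2, if_true]
    split_ifs with h
    · rw [le_antisymm h hs.1]; field_simp; ring
    · ring
  have e2 : ∫ s in (a + T / 2)..(a + 3 * T / 4), gR a T R d δ s =
      ∫ s in (a + T / 2)..(a + 3 * T / 4), -(d / (T / 4)) * (s - (a + T / 2)) := by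
    refine intervalIntegral.integral_congr fun s hs => ?_
    rw [uIcc_of_le (by linarith)] at hs
    have h0 : ¬ s ≤ a + R := by linarith [hs.1]
    simp only [gR, hs.2, h0, if_true, if_false]
    split_ifs with h
    · rw [le_antisymm h hs.1]; simp
    · ring
  have e3 : ∫ s in (a + 3 * T / 4)..(a + T), gR a T R d δ s =
      ∫ s in (a + 3 * T / 4)..(a + T), d / (T / 4) * (s - (a + T)) := by
    refine intervalIntegral.integral_congr fun s hs => ?_
    rw [uIcc_of_le (by linarith)] at hs
    have h0 : ¬ s ≤ a + R := by linarith [hs.1]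
    have h1 : ¬ s ≤ a + T / 2 := by linarith [hs.1]
    simp only [gR, hs.2, h0, h1, if_true, if_false]
    split_ifs with h
    · rw [le_antisymm h hs.1]; ring
    · ring
  rw [integral_add_three (continuous_gR hT hR) _ (a + T / 2) (a + 3 * T / 4), e1, e2, e3,
    integral_affine, integral_affine, integral_affine]
  field_simp
  ring

lemma abs_integral_gR_le (hd : |d| ≤ η) (hδ : |δ| ≤ η) (h1 : a ≤ t) (h2 : t ≤ a + T) :
    |∫ s in (a + T)..t, gR a T R d δ s| ≤ η * T := by
  have h0 : 0 ≤ η := (abs_nonneg _).trans hd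
  refine (intervalIntegral.norm_integral_le_of_norm_le_const (f := gR a T R d δ) (a := a + T)
    (b := t) (C := η) fun s _ => abs_gR_le hd hδ s).trans ?_
  rw [abs_sub_comm, abs_of_nonneg (by linarith)]
  gcongr
  linarith

end

/-! ### One step of the construction -/

/-- The hypotheses under which one insertion step is a small modification: `f` has derivative `F`
with slope bounds near `a`, and `R` is tiny compared with the length `T` on which `f` is modified.
The number `q` measures the size of the modification. -/
structure StepHyp (f F : ℝ → ℝ) (a T R α τ q : ℝ) : Prop where
  T_pos : 0 < T
  T_lt_one : T < 1
  T_le : T ≤ halfLen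
  le_sub : -halfLen ≤ a - T
  q_pos : 0 < q
  q_le : q ≤ 1
  R_pos : 0 < R
  R_le : R ≤ q * T ^ 3 / 3200
  τ_mem : τ ∈ Ioc 0 R
  α_mem : α ∈ Ico (1 : ℝ) 2
  slope : ∀ t ∈ Icc (a - R) (a + R), SlopeBounds f F 2 (2 / T) t
  join : α * wTildeDeriv τ = F a

/-- The derivative of `insertCopy f a T R α τ`, where `F` is the derivative of `f`. -/
noncomputable def insertCopyDeriv (f F : ℝ → ℝ) (a T R α τ : ℝ) : ℝ → ℝ :=
  glue (a - R) (fun t => F t + gL a T R (dL f a T R α τ) (deltaL f a R) t) <|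
  glue (a - τ) (fun _ => deriv f a) <|
  glue (a + τ) (fun t => α * wTildeDeriv (t - a)) <|
  glue (a + R) (fun _ => deriv f a) fun t => F t + gR a T R (dR f a T R α τ) (deltaR f a R) t

namespace StepHyp

variable {f F : ℝ → ℝ} {a T R α τ q : ℝ}

lemma T_pow_le (h : StepHyp f F a T R α τ q) : q * T ^ 3 ≤ q * T ^ 2 := by
  exact mul_le_mul_of_nonneg_left (pow_le_pow_of_le_one h.T_pos.le h.T_lt_one.le (by norm_num))
    h.q_pos.le

lemma R_lt (h : StepHyp f F a T R α τ q) : R < T / 4 := by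
  have h1 : q * T ^ 3 ≤ 1 * T := by
    have : T ^ 3 ≤ T ^ 1 := pow_le_pow_of_le_one h.T_pos.le h.T_lt_one.le (by norm_num)
    rw [pow_one] at this
    exact mul_le_mul h.q_le this (pow_pos h.T_pos 3).le zero_le_one
  linarith [h.R_le, h.T_pos]

lemma R_lt_half (h : StepHyp f F a T R α τ q) : R < T / 2 := by linarith [h.R_lt, h.T_pos]

lemma center_mem (h : StepHyp f F a T R α τ q) : a ∈ Icc (a - R) (a + R) :=
  ⟨by linarith [h.R_pos], by linarith [h.R_pos]⟩

lemma deriv_eq (h : StepHyp f F a T R α τ q) {t : ℝ} (ht : t ∈ Icc (a - R) (a + R)) :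
    deriv f t = F t := (h.slope t ht).1.deriv

lemma abs_deriv_le (h : StepHyp f F a T R α τ q) : |deriv f a| ≤ 2 := by
  rw [h.deriv_eq h.center_mem]; exact (h.slope a h.center_mem).2.1

/-- A function with Lipschitz constant `2 / T` varies by at most this much over a length `R`. -/
lemma R_div_le (h : StepHyp f F a T R α τ q) : 2 / T * R ≤ q * T ^ 2 / 1600 := by
  have hT := h.T_pos
  calc 2 / T * R ≤ 2 / T * (q * T ^ 3 / 3200) := by gcongr; exact h.R_le
    _ = q * T ^ 2 / 1600 := by field_simp; ring

lemma abs_deltaL_le (h : StepHyp f F a T R α τ q) : |deltaL f a R| ≤ q * T ^ 2 / 1600 := by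
  have hR := h.R_pos
  unfold deltaL
  rw [h.deriv_eq h.center_mem, h.deriv_eq ⟨le_rfl, by linarith⟩]
  have := abs_sub_le_of_slopeBounds (show a - R ≤ a by linarith)
    fun t ht => h.slope t ⟨ht.1, by linarith [ht.2]⟩
  rw [sub_sub_cancel] at this
  exact this.trans h.R_div_le

lemma abs_deltaR_le (h : StepHyp f F a T R α τ q) : |deltaR f a R| ≤ q * T ^ 2 / 1600 := by
  have hR := h.R_pos
  unfold deltaR
  rw [h.deriv_eq h.center_mem, h.deriv_eq ⟨by linarith, le_rfl⟩, abs_sub_comm]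
  have := abs_sub_le_of_slopeBounds (show a ≤ a + R by linarith)
    fun t ht => h.slope t ⟨by linarith [ht.1], ht.2⟩
  rw [add_sub_cancel_left] at this
  exact this.trans h.R_div_le

lemma abs_sub_le (h : StepHyp f F a T R α τ q) {s t : ℝ} (hs : s ∈ Icc (a - R) (a + R))
    (ht : t ∈ Icc (a - R) (a + R)) : |f s - f t| ≤ 2 * |s - t| := by
  rcases le_total s t with hst | hst
  · rw [abs_sub_comm, abs_sub_comm s, abs_of_nonneg (sub_nonneg.2 hst)]
    exact abs_sub_le_of_slope_le hst fun r hr => h.slope r ⟨hs.1.trans hr.1, hr.2.trans ht.2⟩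
  · rw [abs_of_nonneg (sub_nonneg.2 hst)]
    exact abs_sub_le_of_slope_le hst fun r hr => h.slope r ⟨ht.1.trans hr.1, hr.2.trans hs.2⟩

lemma abs_mul_wTilde_le (h : StepHyp f F a T R α τ q) (t : ℝ) :
    |α * wTildeAt a t| ≤ 2 * |t - a| := by
  rw [abs_mul, abs_of_pos (by linarith [h.α_mem.1])]
  exact mul_le_mul h.α_mem.2.le (abs_wTilde_le _) (abs_nonneg _) zero_le_two

lemma abs_deriv_mul_le (h : StepHyp f F a T R α τ q) {s : ℝ} (hs : |s| ≤ R) :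
    |deriv f a * s| ≤ 2 * R := by
  rw [abs_mul]
  exact mul_le_mul h.abs_deriv_le hs (abs_nonneg _) zero_le_two

lemma abs_cL_le (h : StepHyp f F a T R α τ q) : |cL f a R α τ| ≤ 8 * R := by
  have hR := h.R_pos
  have hτ := h.τ_mem
  have h1 := h.abs_sub_le h.center_mem ⟨le_refl (a - R), by linarith⟩
  have h2 := h.abs_mul_wTilde_le (a - τ)
  have h3 := h.abs_deriv_mul_le (s := R - τ) (abs_le.2 ⟨by linarith [hτ.2], by linarith [hτ.1]⟩)
  rw [sub_sub_cancel, abs_of_pos hR] at h1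
  rw [sub_sub_cancel_left, abs_neg, abs_of_pos hτ.1] at h2
  unfold cL
  rw [abs_le] at *
  constructor <;> nlinarith [hτ.2]

lemma abs_cR_le (h : StepHyp f F a T R α τ q) : |cR f a R α τ| ≤ 8 * R := by
  have hR := h.R_pos
  have hτ := h.τ_mem
  have h1 := h.abs_sub_le h.center_mem ⟨by linarith, le_refl (a + R)⟩
  have h2 := h.abs_mul_wTilde_le (a + τ)
  have h3 := h.abs_deriv_mul_le (s := R - τ) (abs_le.2 ⟨by linarith [hτ.2], by linarith [hτ.1]⟩)
  rw [sub_add_cancel_left, abs_neg, abs_of_pos hR] at h1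
  rw [add_sub_cancel_left, abs_of_pos hτ.1] at h2
  unfold cR
  rw [abs_le] at *
  constructor <;> nlinarith [hτ.2]

/-- The common estimate for `d_l` and `d_r`. -/
lemma abs_four_div_mul_le (h : StepHyp f F a T R α τ q) {c δ : ℝ} (hc : |c| ≤ 8 * R)
    (hδ : |δ| ≤ q * T ^ 2 / 1600) : |4 / T * (c - δ / 2 * (T / 2 - R))| ≤ q * T ^ 2 / 90 := by
  have hT := h.T_pos
  have h1 : |δ / 2 * (T / 2 - R)| ≤ q * T ^ 2 / 1600 * (T / 4) := by
    have hr : 0 < T / 2 - R := by linarith [h.R_lt_half]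
    have hq := mul_pos h.q_pos (pow_pos hT 2)
    rw [abs_mul, abs_div, abs_two, abs_of_pos hr]
    calc |δ| / 2 * (T / 2 - R) ≤ q * T ^ 2 / 1600 / 2 * (T / 2) := by
          gcongr
          linarith [h.R_pos]
      _ = _ := by ring
  have h2 : |c - δ / 2 * (T / 2 - R)| ≤ 8 * (q * T ^ 3 / 3200) + q * T ^ 2 / 1600 * (T / 4) :=
    (abs_sub _ _).trans (add_le_add (hc.trans (by linarith [h.R_le])) h1)
  rw [abs_mul, abs_of_pos (by positivity)]
  calc _ ≤ 4 / T * (8 * (q * T ^ 3 / 3200) + q * T ^ 2 / 1600 * (T / 4)) := by gcongr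
    _ = q * T ^ 2 * (1 / 100 + 1 / 1600) := by field_simp; ring
    _ ≤ _ := by have := mul_pos h.q_pos (pow_pos hT 2); linarith

lemma abs_dL_le (h : StepHyp f F a T R α τ q) : |dL f a T R α τ| ≤ q * T ^ 2 / 90 :=
  h.abs_four_div_mul_le h.abs_cL_le h.abs_deltaL_le

lemma abs_dR_le (h : StepHyp f F a T R α τ q) : |dR f a T R α τ| ≤ q * T ^ 2 / 90 := by
  have := h.abs_four_div_mul_le (δ := -deltaR f a R) h.abs_cR_le
    (by rw [abs_neg]; exact h.abs_deltaR_le)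
  rwa [neg_div, neg_mul, sub_neg_eq_add] at this

lemma abs_le_of_abs_le (h : StepHyp f F a T R α τ q) {δ : ℝ} (hδ : |δ| ≤ q * T ^ 2 / 1600) :
    |δ| ≤ q * T ^ 2 / 90 := by
  have := mul_pos h.q_pos (pow_pos h.T_pos 2)
  linarith

lemma abs_div_le (h : StepHyp f F a T R α τ q) {d r : ℝ} (hd : |d| ≤ q * T ^ 2 / 90)
    (hr : T / 4 ≤ r) : |d / r| ≤ q := by
  have hT := h.T_pos
  rw [abs_div, abs_of_pos (by linarith : 0 < r), div_le_iff₀ (by linarith)]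
  have h1 : q * T ^ 2 ≤ q * T := mul_le_mul_of_nonneg_left (by nlinarith [h.T_lt_one]) h.q_pos.le
  nlinarith [h.q_pos, mul_pos h.q_pos hT]

lemma gL_lip (h : StepHyp f F a T R α τ q) (s t : ℝ) :
    |gL a T R (dL f a T R α τ) (deltaL f a R) s - gL a T R (dL f a T R α τ) (deltaL f a R) t| ≤
      q * |s - t| :=
  gL_lipschitz h.T_pos h.R_lt_half (h.abs_div_le h.abs_dL_le le_rfl)
    (h.abs_div_le (h.abs_le_of_abs_le h.abs_deltaL_le) (by linarith [h.R_lt])) s t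

lemma gR_lip (h : StepHyp f F a T R α τ q) (s t : ℝ) :
    |gR a T R (dR f a T R α τ) (deltaR f a R) s - gR a T R (dR f a T R α τ) (deltaR f a R) t| ≤
      q * |s - t| :=
  gR_lipschitz h.T_pos h.R_lt_half (h.abs_div_le h.abs_dR_le le_rfl)
    (h.abs_div_le (h.abs_le_of_abs_le h.abs_deltaR_le) (by linarith [h.R_lt])) s t

lemma mul_sq_div_le (h : StepHyp f F a T R α τ q) : q * T ^ 2 / 90 ≤ q := by
  have : T ^ 2 ≤ 1 := pow_le_one₀ h.T_pos.le h.T_lt_one.le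
  have := mul_le_mul_of_nonneg_left this h.q_pos.le
  linarith [h.q_pos]

lemma chiL_slopeBounds (h : StepHyp f F a T R α τ q) (t : ℝ) :
    SlopeBounds (chiL f a T R α τ) (gL a T R (dL f a T R α τ) (deltaL f a R)) q q t := by
  have := slopeBounds_integral h.gL_lip (abs_gL_le (h.abs_dL_le.trans h.mul_sq_div_le)
    ((h.abs_le_of_abs_le h.abs_deltaL_le).trans h.mul_sq_div_le)) (-halfLen) 0 t
  simp only [zero_add] at this
  exact this

lemma chiR_slopeBounds (h : StepHyp f F a T R α τ q) (t : ℝ) :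
    SlopeBounds (chiR f a T R α τ) (gR a T R (dR f a T R α τ) (deltaR f a R)) q q t :=
  slopeBounds_integral h.gR_lip (abs_gR_le (h.abs_dR_le.trans h.mul_sq_div_le)
    ((h.abs_le_of_abs_le h.abs_deltaR_le).trans h.mul_sq_div_le)) (-halfLen) _ t

lemma chiL_eq_zero (h : StepHyp f F a T R α τ q) {t : ℝ} (ht : t ≤ a - T) :
    chiL f a T R α τ t = 0 := integral_gL_eq_zero h.le_sub ht

lemma chiL_eq (h : StepHyp f F a T R α τ q) (t : ℝ) : chiL f a T R α τ t =
    ∫ s in (a - T)..t, gL a T R (dL f a T R α τ) (deltaL f a R) s := by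
  have hc := continuous_of_lipschitz h.gL_lip
  have := intervalIntegral.integral_add_adjacent_intervals
    (hc.intervalIntegrable (μ := volume) (-halfLen) (a - T)) (hc.intervalIntegrable (a - T) t)
  rw [integral_gL_eq_zero h.le_sub le_rfl, zero_add] at this
  exact this.symm

/-- The choice of `d_l` makes `χ_l` equal to `c_l` at the left end of the inner interval. -/
lemma chiL_join (h : StepHyp f F a T R α τ q) : chiL f a T R α τ (a - R) = cL f a R α τ := by
  have hT := h.T_pos
  rw [h.chiL_eq, integral_gL h.T_pos h.R_lt_half]
  unfold dL
  field_simp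
  ring

lemma abs_chiL_le (h : StepHyp f F a T R α τ q) {t : ℝ} (ht : t ≤ a) :
    |chiL f a T R α τ t| ≤ q * T ^ 2 := by
  have hq := mul_pos h.q_pos (pow_pos h.T_pos 2)
  rcases le_total t (a - T) with h1 | h1
  · rw [h.chiL_eq_zero h1, abs_zero]; exact hq.le
  · rw [h.chiL_eq]
    refine (abs_integral_gL_le h.abs_dL_le (h.abs_le_of_abs_le h.abs_deltaL_le) h1 ht).trans ?_
    have := h.T_pow_le
    nlinarith

/-- `χ_r` in terms of the integral from the right end `a + T` of the modified interval: the choice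
of `d_r` makes the boundary terms cancel. -/
lemma chiR_eq (h : StepHyp f F a T R α τ q) (t : ℝ) : chiR f a T R α τ t =
    ∫ s in (a + T)..t, gR a T R (dR f a T R α τ) (deltaR f a R) s := by
  have hc := continuous_of_lipschitz h.gR_lip
  have hT := h.T_pos
  unfold chiR
  rw [integral_add_three hc (-halfLen) (a + R) (a + T) t,
    integral_gR_eq (by linarith [h.le_sub, h.R_pos]) le_rfl, integral_gR h.T_pos h.R_lt_half]
  unfold dR
  field_simp
  ring

lemma chiR_eq_zero (h : StepHyp f F a T R α τ q) {t : ℝ} (ht : a + T ≤ t) :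
    chiR f a T R α τ t = 0 := by
  rw [h.chiR_eq, integral_gR_eq_zero h.T_pos h.R_lt_half ht]

lemma chiR_join (h : StepHyp f F a T R α τ q) : chiR f a T R α τ (a + R) = cR f a R α τ := by
  unfold chiR
  rw [integral_gR_eq (by linarith [h.le_sub, h.R_pos, h.T_pos]) le_rfl]
  ring

lemma abs_chiR_le (h : StepHyp f F a T R α τ q) {t : ℝ} (ht : a ≤ t) :
    |chiR f a T R α τ t| ≤ q * T ^ 2 := by
  have hq := mul_pos h.q_pos (pow_pos h.T_pos 2)
  rcases le_total (a + T) t with h1 | h1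
  · rw [h.chiR_eq_zero h1, abs_zero]; exact hq.le
  · rw [h.chiR_eq]
    refine (abs_integral_gR_le h.abs_dR_le (h.abs_le_of_abs_le h.abs_deltaR_le) ht h1).trans ?_
    have := h.T_pow_le
    nlinarith

lemma insertCopy_of_le (h : StepHyp f F a T R α τ q) {t : ℝ} (ht : t ≤ a - T) :
    insertCopy f a T R α τ t = f t := by
  unfold insertCopy
  rw [if_pos (by linarith [h.R_lt, h.T_pos]), h.chiL_eq_zero ht, add_zero]

lemma insertCopy_of_ge (h : StepHyp f F a T R α τ q) {t : ℝ} (ht : a + T ≤ t) :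
    insertCopy f a T R α τ t = f t := by
  have h1 := h.R_lt
  have h2 := h.T_pos
  have h3 := h.τ_mem.2
  have h4 := h.R_pos
  have h5 := h.τ_mem.1
  unfold insertCopy
  rw [if_neg (by linarith), if_neg (by linarith), if_neg (by linarith), if_neg (by linarith),
    h.chiR_eq_zero ht, add_zero]

lemma insertCopy_of_abs_ge (h : StepHyp f F a T R α τ q) {t : ℝ} (ht : T ≤ |t - a|) :
    insertCopy f a T R α τ t = f t := by
  rcases le_abs.1 ht with ht | ht
  · exact h.insertCopy_of_ge (by linarith)
  · exact h.insertCopy_of_le (by linarith)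

/-- If `τ = R`, the first case in the definition of `insertCopy` includes the point `a - τ`; hence
the strict inequality. -/
lemma insertCopy_near (h : StepHyp f F a T R α τ q) {t : ℝ} (ht : |t - a| < τ) :
    insertCopy f a T R α τ t = α * wTildeAt a t + f a := by
  have h3 := h.τ_mem.2
  rw [abs_lt] at ht
  unfold insertCopy
  rw [if_neg (by linarith), if_neg (by linarith), if_pos (by linarith)]

lemma abs_insertCopy_sub_le (h : StepHyp f F a T R α τ q) (t : ℝ) :
    |insertCopy f a T R α τ t - f t| ≤ q * T ^ 2 := by
  have hτ := h.τ_mem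
  have hR := h.R_pos
  -- On `[a - R, a + R]` the two functions differ by a few terms of size `R`, and `c_l`, `c_r`.
  have hsmall : 14 * R ≤ q * T ^ 2 := by
    have := h.T_pow_le
    have := h.R_le
    have := mul_pos h.q_pos (pow_pos h.T_pos 2)
    linarith
  have hm : ∀ s, |s| ≤ R → |deriv f a * s| ≤ 2 * R := fun s hs => h.abs_deriv_mul_le hs
  have hlip : ∀ s ∈ Icc (a - R) (a + R), ∀ t ∈ Icc (a - R) (a + R), |s - t| ≤ R →
      |f s - f t| ≤ 2 * R := fun s hs t ht hst => (h.abs_sub_le hs ht).trans (by linarith)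
  unfold insertCopy
  split_ifs with h1 h2 h3 h4
  · rw [add_sub_cancel_left]; exact h.abs_chiL_le (by linarith)
  · have e : |t - (a - R)| ≤ R := abs_le.2 ⟨by linarith, by linarith [hτ.1]⟩
    have k1 := hm _ e
    have k2 := hlip t ⟨by linarith [hτ.1, hτ.2], by linarith [hτ.1, hτ.2]⟩ (a - R)
      ⟨by linarith, by linarith⟩ e
    have k3 := h.abs_cL_le
    rw [abs_le] at k1 k2 k3
    rw [abs_le]
    constructor <;> linarith
  · have e : |t - a| ≤ R := abs_le.2 ⟨by linarith [hτ.1, hτ.2], by linarith [hτ.1, hτ.2]⟩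
    have k1 := h.abs_mul_wTilde_le t
    have k2 := hlip t ⟨by linarith [hτ.1, hτ.2], by linarith [hτ.1, hτ.2]⟩ a h.center_mem e
    rw [abs_le] at k1 k2
    rw [abs_le]
    constructor <;> linarith
  · have e : |t - (a + R)| ≤ R := abs_le.2 ⟨by linarith [hτ.1], by linarith⟩
    have k1 := hm _ e
    have k2 := hlip t ⟨by linarith [hτ.1, hτ.2], by linarith [hτ.1, hτ.2]⟩ (a + R)
      ⟨by linarith, by linarith⟩ e
    have k3 := h.abs_cR_le
    rw [abs_le] at k1 k2 k3
    rw [abs_le]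
    constructor <;> linarith
  · rw [add_sub_cancel_left]; exact h.abs_chiR_le (by linarith)

/-- At the points where two pieces meet they have equal values, so it does not matter that `glue`
assigns some of these points to a different piece than `insertCopy` does. -/
lemma insertCopy_eq_glue (h : StepHyp f F a T R α τ q) : insertCopy f a T R α τ =
    glue (a - R) (fun t => f t + chiL f a T R α τ t)
    (glue (a - τ) (fun t => deriv f a * t + (f (a - R) - deriv f a * (a - R) + cL f a R α τ))
    (glue (a + τ) (fun t => α * wTildeAt a t + f a)
    (glue (a + R) (fun t => deriv f a * t + (f (a + R) - deriv f a * (a + R) + cR f a R α τ))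
      fun t => f t + chiR f a T R α τ t))) := by
  have hτ := h.τ_mem.1
  have hτR := h.τ_mem.2
  ext t
  unfold insertCopy glue
  split_ifs with h1 h2 h3 h4 h5 h6 h7 h8 h9 <;> try first | rfl | (exfalso; linarith) | ring1
  · obtain rfl : t = a - τ := by linarith
    unfold cL; ring
  · obtain rfl : t = a + R := by linarith
    rw [h.chiR_join]; ring

/-- The slope bounds after the insertion. Outside `(a - R, a + R)` the first and second derivatives
change by at most `q`; on the two affine pieces the derivative is `F a`; in the middle it is that of
`α * wTilde`. The one-sided derivatives agree where the pieces are joined. -/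
lemma insertCopy_slopeBounds (h : StepHyp f F a T R α τ q) {t ρ κ : ℝ} (hta : t ≠ a)
    (hout : R ≤ |t - a| → SlopeBounds f F (ρ - q) (κ - q) t) (hm : |F a| ≤ ρ) (hκ : 0 ≤ κ)
    (hin : |t - a| ≤ R → |α * wTildeDeriv (t - a)| ≤ ρ ∧ 2 * |wTildeDeriv2 (t - a)| ≤ κ) :
    SlopeBounds (insertCopy f a T R α τ) (insertCopyDeriv f F a T R α τ) ρ κ t := by
  have hτ := h.τ_mem
  have hR := h.R_pos
  have hFa := h.deriv_eq h.center_mem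
  have e1 : a - R ≤ a - τ := by linarith [hτ.2]
  have e2 : a - τ ≤ a + τ := by linarith [hτ.1]
  have e3 : a + τ ≤ a + R := by linarith [hτ.2]
  have hgL : gL a T R (dL f a T R α τ) (deltaL f a R) (a - R) = deltaL f a R := by
    have hR' : T / 2 - R ≠ 0 := by linarith [h.R_lt_half]
    have hT := h.T_pos
    have hRT := h.R_lt
    unfold gL
    rw [if_neg (by linarith), if_neg (by linarith), if_neg (by linarith), if_pos le_rfl,
      show a - R - (a - T / 2) = T / 2 - R by ring, mul_div_cancel_right₀ _ hR']
  have hgR : gR a T R (dR f a T R α τ) (deltaR f a R) (a + R) = deltaR f a R := if_pos le_rfl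
  rw [h.insertCopy_eq_glue]
  refine SlopeBounds.glue (fun ht => ?_) (fun ht1 => SlopeBounds.glue (fun ht => ?_)
    (fun ht2 => SlopeBounds.glue (fun ht3 => ?_) (fun ht => SlopeBounds.glue (fun ht => ?_)
    (fun ht => ?_) ?_ ?_) ?_ ?_) ?_ ?_) ?_ ?_
  · exact ((hout (by rw [abs_sub_comm]; exact le_abs.2 (Or.inl (by linarith)))).add
      (h.chiL_slopeBounds t)).mono (by linarith) (by linarith)
  · exact slopeBounds_affine _ _ _ _ (by rwa [hFa]) hκ
  · have hle : |t - a| ≤ R := abs_le.2 ⟨by linarith [hτ.1, hτ.2], by linarith [hτ.1, hτ.2]⟩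
    have h1 : 1 < -Real.log (t - a) := one_lt_neg_log (sub_ne_zero.2 hta)
      (by linarith [h.R_lt, h.T_le, h.T_pos])
    have hα := h.α_mem
    refine SlopeBounds.of_hasDerivAt
      ((((hasDerivAt_wTilde h1).comp_sub_const t a).const_mul α).add_const _)
      (((hasDerivAt_wTildeDeriv h1).comp_sub_const t a).const_mul α) (hin hle).1 ?_
    refine le_trans ?_ (hin hle).2
    rw [abs_mul, abs_of_pos (by linarith [hα.1])]
    exact mul_le_mul_of_nonneg_right hα.2.le (abs_nonneg _)
  · exact slopeBounds_affine _ _ _ _ (by rwa [hFa]) hκ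
  · exact ((hout (le_abs.2 (Or.inl (by linarith)))).add
      (h.chiR_slopeBounds t)).mono (by linarith) (by linarith)
  · simp only [h.chiR_join]; ring
  · rw [hgR, deltaR, h.deriv_eq (t := a + R) ⟨by linarith, le_rfl⟩]; ring
  · rw [glue_of_le e3]
    unfold cR; ring
  · rw [glue_of_le e3]
    simp only [add_sub_cancel_left]
    rw [h.join, hFa]
  · rw [glue_of_le e2]
    unfold cL; ring
  · rw [glue_of_le e2]
    simp only [sub_sub_cancel_left]
    rw [wTildeDeriv_neg, h.join, hFa]
  · rw [glue_of_le e1]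
    simp only [h.chiL_join]; ring
  · rw [glue_of_le e1]
    rw [hgL, deltaL, h.deriv_eq (t := a - R) ⟨le_rfl, by linarith⟩]; ring

end StepHyp

/-! ### The weight function and the choice of the constants -/

/-- The iterated logarithm in `psi` is positive for arguments up to `2 * halfLen`, the largest
distance between two points of `dom`. The inequality amounts to `5 ≤ exp (e - 1)`. -/
lemma five_mul_two_halfLen_le : 5 * (2 * halfLen) ≤ Real.exp (-1) := by
  have h1 : (2.718 : ℝ) < Real.exp 1 := lt_trans (by norm_num) Real.exp_one_gt_d9
  have h2 : (5 : ℝ) ≤ Real.exp (Real.exp 1 - 1) := by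
    have h3 : (1.945 : ℝ) ≤ Real.exp 0.7 := by
      refine le_trans ?_ (Real.quadratic_le_exp_of_nonneg (by norm_num))
      norm_num
    calc (5 : ℝ) ≤ 2.718 * 1.945 := by norm_num
      _ ≤ Real.exp 1 * Real.exp 0.7 := by gcongr
      _ = Real.exp (1 + 0.7) := (Real.exp_add _ _).symm
      _ ≤ _ := Real.exp_le_exp.2 (by norm_num at h1 ⊢; linarith)
  have h4 : Real.exp (-1) = Real.exp (Real.exp 1 - 1) * Real.exp (-Real.exp 1) := by
    rw [← Real.exp_add]; ring_nf
  rw [h4]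
  unfold halfLen
  have := Real.exp_pos (-Real.exp 1)
  nlinarith

lemma one_lt_log_one_div {t : ℝ} (h0 : t ≠ 0) (ht : |t| < 2 * halfLen) :
    1 < Real.log (1 / (5 * |t|)) := by
  have hpos : 0 < |t| := abs_pos.2 h0
  have : Real.log (5 * |t|) < -1 := by
    rw [Real.log_lt_iff_lt_exp (by positivity)]
    linarith [five_mul_two_halfLen_le]
  rw [one_div, Real.log_inv]
  linarith

lemma continuousAt_wTildeDeriv2 {t : ℝ} (h : 1 < -Real.log t) : ContinuousAt wTildeDeriv2 t := by
  have h0 := ne_zero_of_one_lt_neg_log h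
  have h1 := (hasDerivAt_neg_log h0).continuousAt
  have h2 := (hasDerivAt_log_neg_log h).continuousAt
  have h3 := (hasDerivAt_log_log_neg_log h).continuousAt
  have hne : -Real.log t * Real.log (-Real.log t) ≠ 0 :=
    mul_ne_zero (by linarith) (Real.log_pos h).ne'
  have hs := Real.continuous_sin.continuousAt.comp h3
  have hc := Real.continuous_cos.continuousAt.comp h3
  exact (continuousAt_const.div continuousAt_id h0).neg.mul
    ((hc.div (h1.mul h2) hne).add
      ((hs.add (hc.mul (h2.add continuousAt_const))).div ((h1.mul h2).pow 2) (pow_ne_zero 2 hne)))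

lemma continuousAt_psi {t : ℝ} (h0 : t ≠ 0) (ht : |t| < 2 * halfLen) : ContinuousAt psi t := by
  have h1 := one_lt_log_one_div h0 ht
  have hpos : 0 < |t| := abs_pos.2 h0
  have h2 : 1 / (5 * |t|) ≠ 0 := by positivity
  have h3 : |t| * Real.log (Real.log (1 / (5 * |t|))) ≠ 0 :=
    mul_ne_zero hpos.ne' (Real.log_pos h1).ne'
  have h4 := one_lt_neg_log h0 ht
  have key : psi =ᶠ[𝓝 t] fun t => 402 / (|t| * Real.log (Real.log (1 / (5 * |t|)))) +
      (3 + 4 * |wTildeDeriv2 t|) := by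
    filter_upwards [eventually_one_lt_neg_log h4] with s hs
    have hs0 := ne_zero_of_one_lt_neg_log hs
    simp only [psi, psi1, psi2, if_neg hs0, iteratedDeriv_two_wTilde hs]
  refine ContinuousAt.congr ?_ key.symm
  have h5 := continuousAt_wTildeDeriv2 h4
  have h6 : Real.log (1 / (5 * |t|)) ≠ 0 := by linarith
  have h7 : (5 * |t|) ≠ 0 := by positivity
  refine ContinuousAt.add ?_ (continuousAt_const.add (continuousAt_const.mul h5.abs))
  refine continuousAt_const.div (continuous_abs.continuousAt.mul ?_) h3
  refine ContinuousAt.log (ContinuousAt.log ?_ h2) h6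
  exact continuousAt_const.div (by fun_prop) h7

lemma psi_nonneg {t : ℝ} (ht : |t| < 2 * halfLen) : 0 ≤ psi t := by
  unfold psi psi1 psi2
  split_ifs with h0
  · simp
  · have := Real.log_pos (one_lt_log_one_div h0 ht)
    positivity

/-- The real supremum in `constC` is nonnegative whether or not the set is bounded. -/
lemma one_le_constC : 1 ≤ constC := by
  have : 0 ≤ sSup ((fun t : ℝ => 5 * |t| * psi t) '' dom) := by
    refine Real.sSup_nonneg ?_
    rintro _ ⟨t, ht, rfl⟩
    have := psi_nonneg (t := t) (by linarith [abs_le.2 ht, halfLen_pos])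
    positivity
  unfold constC
  linarith

lemma tendsto_mul_psi : Tendsto (fun t => |t * psi t|) (𝓝[≠] 0) (𝓝 0) := by
  have h1 : Tendsto (fun t : ℝ => 402 * (Real.log (Real.log (1 / (5 * |t|))))⁻¹) (𝓝[≠] 0)
      (𝓝 0) := by
    have : Tendsto (fun t : ℝ => 1 / (5 * |t|)) (𝓝[≠] 0) atTop := by
      simp_rw [one_div]
      refine tendsto_inv_nhdsGT_zero.comp (tendsto_nhdsWithin_iff.2 ⟨?_, ?_⟩)
      · have : Continuous fun t : ℝ => 5 * |t| := by fun_prop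
        simpa using (this.tendsto 0).mono_left nhdsWithin_le_nhds
      · filter_upwards [self_mem_nhdsWithin] with t ht
        have : 0 < |t| := abs_pos.2 ht
        exact mul_pos (by norm_num) this
    simpa using (tendsto_inv_atTop_zero.comp (Real.tendsto_log_atTop.comp
      (Real.tendsto_log_atTop.comp this))).const_mul 402
  have h2 : Tendsto (fun t : ℝ => 3 * |t|) (𝓝[≠] 0) (𝓝 0) := by
    have : Continuous fun t : ℝ => 3 * |t| := by fun_prop
    simpa using (this.tendsto 0).mono_left nhdsWithin_le_nhds
  have h3 := (h1.add h2).add (tendsto_mul_wTildeDeriv2.const_mul 4)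
  norm_num only at h3
  refine h3.congr' ?_
  filter_upwards [eventually_abs_lt_nhdsNE (mul_pos two_pos halfLen_pos)] with t ⟨h0, ht⟩
  have hl := Real.log_pos (one_lt_log_one_div h0 ht)
  have hp : 0 < |t| := abs_pos.2 h0
  rw [abs_mul, abs_of_nonneg (psi_nonneg ht)]
  simp only [psi, psi1, psi2, if_neg h0, iteratedDeriv_two_wTilde (one_lt_neg_log h0 ht)]
  field_simp
  ring

lemma exists_psi_small {e : ℝ} (he : 0 < e) :
    ∀ᶠ r in 𝓝[>] (0 : ℝ), ∀ t, |t| ≤ r → |t * psi t| < e := by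
  have h := tendsto_mul_psi.eventually (gt_mem_nhds he)
  rw [eventually_nhdsWithin_iff, Metric.eventually_nhds_iff] at h
  obtain ⟨δ, hδ, h⟩ := h
  filter_upwards [nhdsWithin_le_nhds (gt_mem_nhds hδ)] with r hr t ht
  by_cases h0 : t = 0
  · simpa [h0] using he
  · exact h (by rw [Real.dist_0_eq_abs]; linarith) h0

/-- A sequence of positive numbers in which each term is chosen after its predecessor. -/
lemma exists_pos_seq {P : ℕ → ℝ → ℝ → Prop} (a : ℝ) (ha : 0 < a)
    (h : ∀ n, ∀ b, 0 < b → ∃ c, 0 < c ∧ P n b c) :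
    ∃ s : ℕ → ℝ, s 0 = a ∧ (∀ n, 0 < s n) ∧ ∀ n, P n (s n) (s (n + 1)) := by
  choose next hpos hP using h
  let s : ℕ → {b : ℝ // 0 < b} := fun n =>
    Nat.rec ⟨a, ha⟩ (fun n b => ⟨next n b.1 b.2, hpos n b.1 b.2⟩) n
  exact ⟨fun n => (s n).1, rfl, fun n => (s n).2, fun n => hP n (s n).1 (s n).2⟩

lemma two_mul_sigma_le (x : ℕ → ℝ) {n i : ℕ} (hi : i < n) : 2 * sigma x n ≤ |x i - x n| := by
  have := ciInf_le (Set.finite_range fun i : Fin n => |x i - x n|).bddBelow ⟨i, hi⟩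
  simp only [sigma] at *
  linarith

lemma sigma_pos {x : ℕ → ℝ} (hx : Function.Injective x) (n : ℕ) : 0 < sigma x (n + 1) := by
  obtain ⟨i, hi⟩ := exists_eq_ciInf_of_finite (f := fun i : Fin (n + 1) => |x i - x (n + 1)|)
  unfold sigma
  rw [← hi]
  have : x i ≠ x (n + 1) := fun h => by have := hx h; have := i.2; omega
  have := abs_pos.2 (sub_ne_zero.2 this)
  positivity

lemma abs_sub_lt {s t : ℝ} (hs : s ∈ Ioo (-halfLen) halfLen) (ht : t ∈ dom) :
    |t - s| < 2 * halfLen :=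
  abs_lt.2 ⟨by linarith [hs.2, ht.1], by linarith [hs.1, ht.2]⟩

lemma eps_pos (n : ℕ) : 0 < eps n := by
  have : Real.exp (-1) < 1 := Real.exp_lt_one_iff.2 (by norm_num)
  unfold eps
  have : 0 < 1 - Real.exp (-1) := by linarith
  positivity

section

variable {x : ℕ → ℝ}

lemma exists_K_bound (hx_mem : ∀ n, x n ∈ Ioo (-halfLen) halfLen)
    (hx_inj : Function.Injective x) (n : ℕ) :
    ∃ B, ∀ t ∈ dom, (∀ i ≤ n, sigma x (n + 1) ≤ |x i - t|) →
    2 * ∑ i ∈ Finset.range (n + 1), |iteratedDeriv 2 (wTildeAt (x i)) t| ≤ B := by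
  have hσ := sigma_pos hx_inj n
  have hcl : IsClosed {t | ∀ i ≤ n, sigma x (n + 1) ≤ |x i - t|} := by
    simp only [ofPred_forall]
    exact isClosed_iInter fun i => isClosed_iInter fun _ =>
      isClosed_le continuous_const (by fun_prop)
  have hcomp : IsCompact (dom ∩ {t | ∀ i ≤ n, sigma x (n + 1) ≤ |x i - t|}) :=
    isCompact_Icc.inter_right hcl
  have hlog : ∀ t ∈ dom ∩ {t | ∀ i ≤ n, sigma x (n + 1) ≤ |x i - t|}, ∀ i ∈ Finset.range (n + 1),
      1 < -Real.log (t - x i) := fun t ht i hi => by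
    refine one_lt_neg_log (fun h => ?_) (abs_sub_lt (hx_mem i) ht.1)
    have := ht.2 i (Nat.lt_succ_iff.1 (Finset.mem_range.1 hi))
    rw [← sub_eq_zero.1 h, sub_self, abs_zero] at this
    linarith
  obtain ⟨B, hB⟩ := hcomp.exists_bound_of_continuousOn
    (f := fun t => 2 * ∑ i ∈ Finset.range (n + 1), |wTildeDeriv2 (t - x i)|) (by
      refine continuousOn_const.mul (continuousOn_finsetSum _ fun i hi t ht => ?_)
      have hc := continuousAt_wTildeDeriv2 (hlog t ht i hi)
      exact (hc.comp (f := fun t => t - x i) (by fun_prop)).abs.continuousWithinAt)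
  refine ⟨B, fun t ht hti => ?_⟩
  have := (le_abs_self _).trans (hB t ⟨ht, hti⟩)
  refine le_trans (le_of_eq ?_) this
  congr 1
  refine Finset.sum_congr rfl fun i hi => ?_
  rw [iteratedDeriv_two_wTildeAt, iteratedDeriv_two_wTilde (hlog t ⟨ht, hti⟩ i hi)]

lemma exists_M_bound (hx_mem : ∀ n, x n ∈ Ioo (-halfLen) halfLen)
    {G : Set ℝ} (hG : IsOpen G) {m : ℕ} (hcov : ∀ i ≤ m, x i ∈ G) (T : ℕ → ℝ) :
    ∃ M, 1 < M ∧ ∀ t ∈ dom \ G,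
      ∑ i ∈ Finset.range (m + 1), max (psi (t - x i)) (psi (T i)) ≤ M := by
  obtain ⟨B, hB⟩ := (isCompact_Icc.diff hG : IsCompact (dom \ G)).exists_bound_of_continuousOn
    (f := fun t => ∑ i ∈ Finset.range (m + 1), max (psi (t - x i)) (psi (T i))) (by
      refine continuousOn_finsetSum _ fun i hi t ht => ?_
      have hne : t - x i ≠ 0 := fun h => ht.2 <| by
        rw [sub_eq_zero.1 h]; exact hcov i (Nat.lt_succ_iff.1 (Finset.mem_range.1 hi))
      have hc := continuousAt_psi hne (abs_sub_lt (hx_mem i) ht.1)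
      have hc' := hc.comp (f := fun t => t - x i) (by fun_prop)
      have : ContinuousAt (fun t => max (psi (t - x i)) (psi (T i))) t := hc'.max continuousAt_const
      exact this.continuousWithinAt)
  exact ⟨max 2 B, lt_max_of_lt_left one_lt_two, fun t ht =>
    ((le_abs_self _).trans (hB t ht)).trans (le_max_right _ _)⟩

/-- A finite set is null, so outer regularity gives a small open neighbourhood. -/
lemma exists_open_cover (hx_mem : ∀ n, x n ∈ Ioo (-halfLen) halfLen)
    (m : ℕ) {e : ℝ} (he : 0 < e) : ∃ G : Set ℝ, IsOpen G ∧ G ⊆ dom ∧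
    (∀ i ≤ m, x i ∈ G) ∧ volume G ≤ ENNReal.ofReal e := by
  have h0 : volume (x '' Iic m) = 0 := ((finite_Iic m).image x).measure_zero _
  obtain ⟨U, hU, hUo, hUv⟩ := (x '' Iic m).exists_isOpen_lt_of_lt (μ := volume) (ENNReal.ofReal e)
    (by rw [h0]; exact ENNReal.ofReal_pos.2 he)
  exact ⟨U ∩ Ioo (-halfLen) halfLen, hUo.inter isOpen_Ioo,
    inter_subset_right.trans Ioo_subset_Icc_self,
    fun i hi => ⟨hU ⟨i, hi, rfl⟩, hx_mem i⟩, (measure_mono inter_subset_left).trans hUv.le⟩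

/-- The constants of the construction can be chosen. -/
lemma nonempty_constants (hx_mem : ∀ n, x n ∈ Ioo (-halfLen) halfLen)
    (hx_inj : Function.Injective x) (hx_zero : x 0 = 0) : Nonempty (Constants x) := by
  choose B hB using exists_K_bound hx_mem hx_inj
  obtain ⟨K, hK0, hKpos, hK⟩ := exists_pos_seq (P := fun n a b => 1 + a ≤ b ∧ B n ≤ b) 1 one_pos
    fun n a ha => ⟨max (1 + a) (B n), lt_max_of_lt_left (by linarith), le_max_left _ _,
      le_max_right _ _⟩
  have small : ∀ {r : ℝ}, 0 < r → ∀ᶠ s in 𝓝[>] (0 : ℝ), s < r := fun hr =>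
    nhdsWithin_le_nhds (gt_mem_nhds hr)
  obtain ⟨T, hT0, hTpos, hT⟩ := exists_pos_seq (P := fun n a b => b < 1 ∧
      ivl (x (n + 1)) b ⊆ dom ∧ b < sigma x (n + 1) ∧ b < a / 2 ∧
      (∀ t ∈ ivl (x (n + 1)) b, |(t - x (n + 1)) * psi (t - x (n + 1))| < (1 / 2) ^ (n + 1) / 5) ∧
      b < (K (n + 1))⁻¹) halfLen halfLen_pos fun n a ha => by
    have hx := hx_mem (n + 1)
    obtain ⟨b, h0, h1, h2, h3, h4, h5, h6, h7⟩ := ((eventually_mem_nhdsWithin).and <|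
      (small one_pos).and <| (small (sub_pos.2 hx.2)).and <| (small (sub_pos.2 hx.1)).and <|
      (small (sigma_pos hx_inj n)).and <| (small (half_pos ha)).and <|
      (exists_psi_small (e := (1 / 2) ^ (n + 1) / 5) (by positivity)).and
      (small (inv_pos.2 (hKpos (n + 1))))).exists
    exact ⟨b, h0, h1, fun t ht => ⟨by linarith [ht.1], by linarith [ht.2]⟩, h4, h5,
      fun t ht => h6 _ (abs_le.2 ⟨by linarith [ht.1], by linarith [ht.2]⟩), h7⟩
  have hm : ∀ n, ∃ m, n < m ∧ (1 / 2 : ℝ) ^ m < T (n + 1) ^ 2 / 256 := fun n => by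
    have h := (tendsto_pow_atTop_nhds_zero_of_lt_one (r := (1 / 2 : ℝ)) (by norm_num)
      (by norm_num)).eventually (gt_mem_nhds (show 0 < T (n + 1) ^ 2 / 256 by
        have := hTpos (n + 1); positivity))
    exact ((eventually_gt_atTop n).and h).exists
  choose m hnm hm using hm
  have hC : 0 < constC := one_pos.trans_le one_le_constC
  choose G hGo hGs hGc hGv using fun n => exists_open_cover hx_mem (m n)
    (e := T (n + 1) ^ 2 / (16 * constC)) (by have := hTpos (n + 1); positivity)
  choose M hM1 hM using fun n => exists_M_bound hx_mem (hGo n) (hGc n) T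
  obtain ⟨R, hR0, hRpos, hR⟩ := exists_pos_seq (P := fun n a b => b ≤ T (n + 1) ∧
      1 / (Real.log (Real.log (1 / b)) * Real.log (1 / b)) < eps (n + 1) / 2 ∧ b < a / 2 ∧
      b < (1 / 2) ^ (n + 1) * T (n + 1) ^ 3 * eps (n + 1) / (128 * 25 * M n)) (T 0) (hTpos 0)
      fun n a ha => by
    have hlog : ∀ᶠ b in 𝓝[>] (0 : ℝ),
        1 / (Real.log (Real.log (1 / b)) * Real.log (1 / b)) < eps (n + 1) / 2 := by
      have h := (tendsto_inv_atTop_zero.comp tendsto_neg_log_mul_log).eventually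
        (gt_mem_nhds (half_pos (eps_pos (n + 1))))
      filter_upwards [nhdsGT_le_nhdsNE _ h] with b hb
      rwa [one_div b, Real.log_inv, one_div, mul_comm]
    obtain ⟨b, h0, h1, h2, h3, h4⟩ := ((eventually_mem_nhdsWithin).and <|
      (small (hTpos (n + 1))).and <| hlog.and <| (small (half_pos ha)).and <|
      small (r := (1 / 2) ^ (n + 1) * T (n + 1) ^ 3 * eps (n + 1) / (128 * 25 * M n)) (by
        have := hTpos (n + 1); have := eps_pos (n + 1); have := one_pos.trans (hM1 n)
        positivity)).exists
    exact ⟨b, h0, h1.le, h2, h3, h4⟩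
  have hT1 : ∀ n, T n < 1 := fun n => by
    cases n with
    | zero => rw [hT0]; linarith [halfLen_lt_half]
    | succ n => exact (hT n).1
  exact ⟨{
    K := K
    K_zero := hK0
    K_succ := fun n => (hK n).1
    K_bound := fun n t ht hti => (hB n t ht hti).trans (hK n).2
    T := T
    T_zero := hT0
    T_mem := fun n => ⟨hTpos n, hT1 n⟩
    T_sub := fun n => by
      cases n with
      | zero => rw [hT0, hx_zero, ivl, zero_sub, zero_add]; exact subset_rfl
      | succ n => exact (hT n).2.1
    T_sigma := fun n => (hT n).2.2.1
    T_half := fun n => (hT n).2.2.2.1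
    T_psi := fun n => (hT n).2.2.2.2.1
    T_K := fun n => (hT n).2.2.2.2.2
    m := m
    lt_m := hnm
    m_bound := hm
    G := G
    G_open := hGo
    G_sub := hGs
    G_cover := hGc
    G_meas := hGv
    M := M
    one_lt_M := hM1
    M_bound := hM
    R := R
    R_zero := hR0
    R_mem := fun n => ⟨hRpos n, by
      cases n with
      | zero => exact hR0.le
      | succ n => exact (hR n).1⟩
    R_log := fun n => (hR n).2.1
    R_half := fun n => (hR n).2.2.1
    R_small := fun n => (hR n).2.2.2 }⟩

end

/-! ### The induction -/

lemma eps_succ (n : ℕ) : eps (n + 1) = eps n / 2 := by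
  unfold eps; ring

lemma eps_le (n : ℕ) : eps n ≤ (1 / 2) ^ n := by
  have := Real.exp_pos (-1)
  exact mul_le_of_le_one_right (by positivity) (by linarith)

lemma two_sub_eps_zero : 2 - eps 0 = 1 + Real.exp (-1) := by
  simp only [eps, pow_zero]; ring

variable {x : ℕ → ℝ}

/-- What is known of `f = w_n`: it is continuous, and away from `x_0, …, x_n` its first and second
derivatives are bounded as in the construction. -/
structure StageInv (x : ℕ → ℝ) (n : ℕ) (f : ℝ → ℝ) : Prop where
  cont : ∀ t ∈ Ioo (-halfLen) halfLen, ContinuousAt f t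
  slope : ∃ F, ∀ t ∈ Ioo (-halfLen) halfLen, (∀ i ≤ n, t ≠ x i) →
    SlopeBounds f F (2 - eps n)
      (2 * ∑ i ∈ Finset.range (n + 1), |wTildeDeriv2 (t - x i)| + (1 - (1 / 2) ^ n)) t

/-- The conditions on `α_{n+1}` and `τ_{n+1}` when `f = w_n`. -/
structure StepChoice (c : Constants x) (n : ℕ) (f : ℝ → ℝ) (α τ : ℝ) : Prop where
  α_mem : α ∈ Ico (1 : ℝ) 2
  steep : ∀ t ∈ ivl (x (n + 1)) (c.R (n + 1)) \ {x (n + 1)},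
    |α * deriv (wTildeAt (x (n + 1))) t| < 2 - eps (n + 1)
  τ_mem : τ ∈ Ioc 0 (c.R (n + 1))
  join : α * deriv (wTildeAt (x (n + 1))) (x (n + 1) - τ) = deriv f (x (n + 1))

namespace Constants

variable (c : Constants x)

lemma T_le (n : ℕ) : c.T n ≤ halfLen := by
  have h := c.T_sub n
  have hT := (c.T_mem n).1
  have h1 := (h (left_mem_Icc.2 (by linarith))).1
  have h2 := (h (right_mem_Icc.2 (by linarith))).2
  linarith

lemma le_sub (n : ℕ) : -halfLen ≤ x n - c.T n :=
  (c.T_sub n (left_mem_Icc.2 (by linarith [(c.T_mem n).1]))).1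

lemma add_le (n : ℕ) : x n + c.T n ≤ halfLen :=
  (c.T_sub n (right_mem_Icc.2 (by linarith [(c.T_mem n).1]))).2

lemma center_mem (c : Constants x) (n : ℕ) : x n ∈ Ioo (-halfLen) halfLen :=
  ⟨by linarith [c.le_sub n, (c.T_mem n).1], by linarith [c.add_le n, (c.T_mem n).1]⟩

lemma one_le_K (n : ℕ) : 1 ≤ c.K n := by
  induction n with
  | zero => exact c.K_zero.ge
  | succ n ih => linarith [c.K_succ n]

end Constants

/-- The size of the `n`-th modification. -/
noncomputable def stepSize (n : ℕ) : ℝ := (1 / 2) ^ n * eps n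

lemma stepSize_pos (n : ℕ) : 0 < stepSize n := mul_pos (by positivity) (eps_pos n)

lemma stepSize_le_eps (n : ℕ) : stepSize n ≤ eps n :=
  mul_le_of_le_one_left (eps_pos n).le (pow_le_one₀ (by norm_num) (by norm_num))

lemma stepSize_le_pow (n : ℕ) : stepSize n ≤ (1 / 2) ^ n :=
  (stepSize_le_eps n).trans (eps_le n)

namespace Constants

variable (c : Constants x) {n : ℕ}

lemma R_le : c.R (n + 1) ≤ stepSize (n + 1) * c.T (n + 1) ^ 3 / 3200 := by
  refine (c.R_small n).le.trans ?_
  have hM := c.one_lt_M n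
  have hT := (c.T_mem (n + 1)).1
  have hq := eps_pos (n + 1)
  rw [stepSize]
  calc _ ≤ (1 / 2) ^ (n + 1) * c.T (n + 1) ^ 3 * eps (n + 1) / (128 * 25 * 1) := by gcongr
    _ = _ := by ring

/-- The earlier points stay away from the interval on which the next modification takes place. -/
lemma sigma_le {t : ℝ} (ht : |t - x (n + 1)| ≤ c.T (n + 1)) {i : ℕ} (hi : i ≤ n) :
    sigma x (n + 1) ≤ |x i - t| := by
  have h1 := two_mul_sigma_le x (Nat.lt_succ_of_le hi)
  have h2 := c.T_sigma n
  have h3 := abs_sub_le (x i) t (x (n + 1))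
  linarith

lemma T_lt_abs {i : ℕ} (hi : i ≤ n) : c.T (n + 1) < |x i - x (n + 1)| := by
  have h1 := c.sigma_le (t := x (n + 1)) (by simpa using (c.T_mem (n + 1)).1.le) hi
  exact (c.T_sigma n).trans_le h1

lemma ne_of_abs_le {t : ℝ} (ht : |t - x (n + 1)| ≤ c.T (n + 1)) {i : ℕ} (hi : i ≤ n) :
    t ≠ x i := by
  rintro rfl
  exact absurd ht (c.T_lt_abs hi).not_ge

lemma R_lt_half : c.R (n + 1) < c.T (n + 1) / 2 := by
  have h1 := c.R_le (n := n)
  have hT := c.T_mem (n + 1)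
  have h2 : stepSize (n + 1) * c.T (n + 1) ^ 3 ≤ 1 * c.T (n + 1) := by
    have h3 : c.T (n + 1) ^ 3 ≤ c.T (n + 1) ^ 1 :=
      pow_le_pow_of_le_one hT.1.le hT.2.le (by norm_num)
    rw [pow_one] at h3
    exact mul_le_mul ((stepSize_le_pow _).trans (pow_le_one₀ (by norm_num) (by norm_num))) h3
      (pow_pos hT.1 3).le zero_le_one
  linarith [hT.1]

lemma mem_of_abs_le_R {t : ℝ} (ht : |t - x (n + 1)| ≤ c.R (n + 1)) :
    t ∈ Ioo (-halfLen) halfLen := by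
  have h1 := c.R_lt_half (n := n)
  have h2 := (c.T_mem (n + 1)).1
  have := c.le_sub (n + 1)
  have := c.add_le (n + 1)
  rw [abs_le] at ht
  constructor <;> linarith

/-- Near `x_{n+1}` the second derivative of `w_n` is at most `K_{n+1} + 1`, which is less than
`2 / T_{n+1}`. -/
lemma slope_near {f F : ℝ → ℝ} (hF : ∀ t ∈ Ioo (-halfLen) halfLen, (∀ i ≤ n, t ≠ x i) →
    SlopeBounds f F (2 - eps n)
      (2 * ∑ i ∈ Finset.range (n + 1), |wTildeDeriv2 (t - x i)| + (1 - (1 / 2) ^ n)) t)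
    {t : ℝ} (ht : |t - x (n + 1)| ≤ c.R (n + 1)) :
    SlopeBounds f F (2 - eps n) (2 / c.T (n + 1)) t := by
  have hT := (c.T_mem (n + 1)).1
  have htT : |t - x (n + 1)| ≤ c.T (n + 1) := by linarith [c.R_lt_half (n := n)]
  have hmem := c.mem_of_abs_le_R ht
  have hne : ∀ i ≤ n, t ≠ x i := fun i hi => c.ne_of_abs_le htT hi
  have hdom : t ∈ dom := Ioo_subset_Icc_self hmem
  refine (hF t hmem hne).mono le_rfl ?_
  have h1 := c.K_bound n t hdom fun i hi => c.sigma_le htT hi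
  have h2 : ∑ i ∈ Finset.range (n + 1), |iteratedDeriv 2 (wTildeAt (x i)) t| =
      ∑ i ∈ Finset.range (n + 1), |wTildeDeriv2 (t - x i)| := by
    refine Finset.sum_congr rfl fun i hi => ?_
    rw [iteratedDeriv_two_wTildeAt, iteratedDeriv_two_wTilde]
    exact one_lt_neg_log (sub_ne_zero.2 (hne i (Nat.lt_succ_iff.1 (Finset.mem_range.1 hi))))
      (abs_sub_lt (c.center_mem i) hdom)
  rw [h2] at h1
  have h3 : c.K (n + 1) < 1 / c.T (n + 1) := by
    rw [lt_one_div (by linarith [c.one_le_K (n + 1)]) hT, one_div]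
    exact c.T_K n
  have h4 := c.one_le_K (n + 1)
  have h5 : (0 : ℝ) < (1 / 2) ^ n := by positivity
  rw [show 2 / c.T (n + 1) = 1 / c.T (n + 1) + 1 / c.T (n + 1) by ring]
  linarith

end Constants

lemma StepChoice.stepHyp {c : Constants x} {n : ℕ} {f F : ℝ → ℝ} {α τ : ℝ}
    (h : StepChoice c n f α τ)
    (hF : ∀ t ∈ Ioo (-halfLen) halfLen, (∀ i ≤ n, t ≠ x i) → SlopeBounds f F (2 - eps n)
      (2 * ∑ i ∈ Finset.range (n + 1), |wTildeDeriv2 (t - x i)| + (1 - (1 / 2) ^ n)) t) :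
    StepHyp f F (x (n + 1)) (c.T (n + 1)) (c.R (n + 1)) α τ (stepSize (n + 1)) where
  T_pos := (c.T_mem _).1
  T_lt_one := (c.T_mem _).2
  T_le := c.T_le _
  le_sub := c.le_sub _
  q_pos := stepSize_pos _
  q_le := (stepSize_le_pow _).trans (pow_le_one₀ (by norm_num) (by norm_num))
  R_pos := (c.R_mem _).1
  R_le := c.R_le
  τ_mem := h.τ_mem
  α_mem := h.α_mem
  slope := fun t ht => (c.slope_near hF (abs_le.2 ⟨by linarith [ht.1], by linarith [ht.2]⟩)).mono
    (by linarith [eps_pos n]) le_rfl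
  join := by
    have hR := (c.R_mem (n + 1)).1
    have h1 := (c.slope_near hF (t := x (n + 1)) (by simpa using hR.le)).1.deriv
    have h2 := h.join
    have hτ := h.τ_mem
    have hlog : 1 < -Real.log (-τ) := by
      refine one_lt_neg_log (by linarith [hτ.1]) ?_
      rw [abs_neg, abs_of_pos hτ.1]
      have := c.R_lt_half (n := n)
      linarith [c.T_le (n + 1), hτ.2]
    rw [deriv_wTildeAt (by rwa [sub_sub_cancel_left]), sub_sub_cancel_left, wTildeDeriv_neg,
      h1] at h2
    exact h2

lemma deriv_wTildeAt_of_near (c : Constants x) {n : ℕ} {t : ℝ} (ht : t ≠ x (n + 1))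
    (hR : |t - x (n + 1)| ≤ c.R (n + 1)) :
    deriv (wTildeAt (x (n + 1))) t = wTildeDeriv (t - x (n + 1)) :=
  deriv_wTildeAt (one_lt_neg_log (sub_ne_zero.2 ht)
    (abs_sub_lt (c.center_mem _) (Ioo_subset_Icc_self (c.mem_of_abs_le_R hR))))

/-- The bounds are passed on to the next function: the modification costs `stepSize (n + 1)` in the
slope, less than the difference `ε_{n+1}` between the old and the new bound. -/
lemma StageInv.succ {c : Constants x} {n : ℕ} {f : ℝ → ℝ} {α τ : ℝ} (hf : StageInv x n f)
    (h : StepChoice c n f α τ) :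
    StageInv x (n + 1) (insertCopy f (x (n + 1)) (c.T (n + 1)) (c.R (n + 1)) α τ) := by
  obtain ⟨F, hF⟩ := hf.slope
  have hs := h.stepHyp hF
  have hslope : ∀ t ∈ Ioo (-halfLen) halfLen, (∀ i ≤ n + 1, t ≠ x i) →
      SlopeBounds (insertCopy f (x (n + 1)) (c.T (n + 1)) (c.R (n + 1)) α τ)
      (insertCopyDeriv f F (x (n + 1)) (c.T (n + 1)) (c.R (n + 1)) α τ) (2 - eps (n + 1))
      (2 * ∑ i ∈ Finset.range (n + 1 + 1), |wTildeDeriv2 (t - x i)| +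
        (1 - (1 / 2) ^ (n + 1))) t := fun t ht hti => by
    have hq := stepSize_le_eps (n + 1)
    have hq' := stepSize_le_pow (n + 1)
    have he := eps_succ n
    have hep := eps_pos (n + 1)
    have hpow : (1 / 2 : ℝ) ^ n = (1 / 2) ^ (n + 1) + (1 / 2) ^ (n + 1) := by ring
    have hpow1 : (1 / 2 : ℝ) ^ (n + 1) ≤ 1 := pow_le_one₀ (by norm_num) (by norm_num)
    have hsum : 0 ≤ ∑ i ∈ Finset.range (n + 1), |wTildeDeriv2 (t - x i)| :=
      Finset.sum_nonneg fun _ _ => abs_nonneg _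
    have hlast := abs_nonneg (wTildeDeriv2 (t - x (n + 1)))
    rw [Finset.sum_range_succ _ (n + 1)]
    refine hs.insertCopy_slopeBounds (hti (n + 1) le_rfl) (fun _ => ?_) ?_ ?_ (fun ht' => ⟨?_, ?_⟩)
    · exact (hF t ht fun i hi => hti i (by omega)).mono (by linarith) (by linarith)
    · refine (c.slope_near hF (t := x (n + 1)) (by simpa using hs.R_pos.le)).2.1.trans ?_
      linarith
    · linarith
    · have := h.steep t ⟨⟨by linarith [(abs_le.1 ht').1], by linarith [(abs_le.1 ht').2]⟩,
        hti (n + 1) le_rfl⟩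
      rw [deriv_wTildeAt_of_near c (hti (n + 1) le_rfl) ht'] at this
      exact this.le
    · linarith
  refine ⟨fun t ht => ?_, ⟨_, hslope⟩⟩
  by_cases hti : ∀ i ≤ n + 1, t ≠ x i
  · exact (hslope t ht hti).1.continuousAt
  push Not at hti
  obtain ⟨i, hi, rfl⟩ := hti
  have hcont : ContinuousAt (fun t => |t - x (n + 1)|) (x i) := by fun_prop
  rcases hi.lt_or_eq with hi | rfl
  · have : ∀ᶠ t in 𝓝 (x i), c.T (n + 1) < |t - x (n + 1)| :=
      hcont.eventually (lt_mem_nhds (c.T_lt_abs (by omega)))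
    refine (hf.cont _ ht).congr ?_
    filter_upwards [this] with t ht using (hs.insertCopy_of_abs_ge ht.le).symm
  · have : ∀ᶠ t in 𝓝 (x (n + 1)), |t - x (n + 1)| < τ :=
      hcont.eventually (gt_mem_nhds (by simpa using hs.τ_mem.1))
    have h1 : ContinuousAt (wTildeAt (x (n + 1))) (x (n + 1)) :=
      ContinuousAt.comp (g := wTilde) (f := fun t => t - x (n + 1))
        (by rw [sub_self]; exact continuousAt_wTilde_zero) (by fun_prop)
    refine ((h1.const_mul α).add (continuousAt_const (y := f (x (n + 1))))).congr ?_
    filter_upwards [this] with t ht using (hs.insertCopy_near ht).symm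

lemma stageInv_zero (hx_zero : x 0 = 0) : StageInv x 0 (wTildeAt (x 0)) := by
  have hslope : ∀ t ∈ Ioo (-halfLen) halfLen, (∀ i ≤ 0, t ≠ x i) →
      SlopeBounds (wTildeAt (x 0)) wTildeDeriv (2 - eps 0)
      (2 * ∑ i ∈ Finset.range (0 + 1), |wTildeDeriv2 (t - x i)| + (1 - (1 / 2) ^ 0)) t :=
      fun t ht hti => by
    have h0 : t ≠ 0 := by rw [← hx_zero]; exact hti 0 le_rfl
    have hlt : |t| < 2 * halfLen := by
      have := halfLen_pos
      exact abs_lt.2 ⟨by linarith [ht.1], by linarith [ht.2]⟩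
    have h1 := one_lt_neg_log h0 hlt
    have h2 := one_lt_log_neg_log h0 hlt
    have h3 := exp_one_lt_neg_log h0 hlt
    have e : wTildeAt (x 0) = wTilde := by ext t; simp [wTildeAt, hx_zero]
    rw [e]
    refine SlopeBounds.of_hasDerivAt (hasDerivAt_wTilde h1) (hasDerivAt_wTildeDeriv h1) ?_ ?_
    · refine (abs_wTildeDeriv_le h0 hlt).trans ?_
      rw [two_sub_eps_zero, Real.exp_neg, ← one_div]
      gcongr
      nlinarith [Real.exp_pos 1]
    · simp only [zero_add, Finset.sum_range_one, hx_zero, sub_zero, pow_zero, sub_self, add_zero]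
      linarith [abs_nonneg (wTildeDeriv2 t)]
  refine ⟨fun t ht => ?_, _, hslope⟩
  by_cases h : t = x 0
  · subst h
    exact ContinuousAt.comp (g := wTilde) (f := fun t => t - x 0)
      (by rw [sub_self]; exact continuousAt_wTilde_zero) (by fun_prop)
  · exact (hslope t ht fun i hi => by rwa [Nat.le_zero.1 hi]).1.continuousAt

/-- `α_{n+1} = max 1 |m|` is admissible: `|w_n'| ≤ 2 - ε_n = 2 - 2 ε_{n+1}`, and on `Z_{n+1}` the
slope of `wTilde` exceeds `1` by less than `ε_{n+1} / 2`. -/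
lemma StageInv.exists_stepChoice (c : Constants x) {n : ℕ} {f : ℝ → ℝ} (hf : StageInv x n f) :
    ∃ α τ, StepChoice c n f α τ := by
  obtain ⟨F, hF⟩ := hf.slope
  have hR := (c.R_mem (n + 1)).1
  have hRT := c.R_lt_half (n := n)
  have hTh := c.T_le (n + 1)
  have hT := (c.T_mem (n + 1)).1
  have hm : |deriv f (x (n + 1))| ≤ 2 - eps n := by
    have := c.slope_near hF (t := x (n + 1)) (by simpa using hR.le)
    rw [this.1.deriv]; exact this.2.1
  have he := eps_succ n
  have hep := eps_pos (n + 1)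
  have hep1 : eps (n + 1) ≤ 1 / 2 := by
    refine (eps_le _).trans ?_
    rw [pow_succ]
    linarith [pow_le_one₀ (n := n) (by norm_num : (0 : ℝ) ≤ 1 / 2) (by norm_num)]
  set m := deriv f (x (n + 1)) with hm_def
  set α := max 1 |m| with hα_def
  have hα1 : 1 ≤ α := le_max_left _ _
  have hα2 : α ≤ 2 - 2 * eps (n + 1) := max_le (by linarith) (by linarith)
  have hα0 : 0 < α := by linarith
  obtain ⟨τ, hτ, hτv⟩ := exists_wTildeDeriv_eq (v := m / α) hR (by
    rw [abs_div, abs_of_pos hα0]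
    exact div_le_one_of_le₀ (le_max_right _ _) hα0.le)
  refine ⟨α, τ, ⟨hα1, by linarith⟩, fun t ht => ?_, hτ, ?_⟩
  · have htR : |t - x (n + 1)| ≤ c.R (n + 1) :=
      abs_le.2 ⟨by linarith [ht.1.1], by linarith [ht.1.2]⟩
    rw [deriv_wTildeAt_of_near c ht.2 htR]
    have h0 : t - x (n + 1) ≠ 0 := sub_ne_zero.2 ht.2
    have hlt : |t - x (n + 1)| < 2 * halfLen := by linarith
    have hR0 : c.R (n + 1) ≠ 0 := hR.ne'
    have hRlt : |c.R (n + 1)| < 2 * halfLen := by rw [abs_of_pos hR]; linarith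
    have hRlog := c.R_log n
    rw [one_div (c.R (n + 1)), Real.log_inv, mul_comm] at hRlog
    have k1 := one_lt_neg_log hR0 hRlt
    have k2 := one_lt_log_neg_log hR0 hRlt
    have hmono : -Real.log (c.R (n + 1)) ≤ -Real.log (t - x (n + 1)) := by
      rw [neg_le_neg_iff, ← Real.log_abs]
      exact Real.log_le_log (abs_pos.2 h0) htR
    have hmono2 := Real.log_le_log (by linarith) hmono
    have hD := abs_wTildeDeriv_le h0 hlt
    have h3 : 1 / (-Real.log (t - x (n + 1)) * Real.log (-Real.log (t - x (n + 1)))) ≤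
        1 / (-Real.log (c.R (n + 1)) * Real.log (-Real.log (c.R (n + 1)))) := by
      have : 0 < -Real.log (c.R (n + 1)) * Real.log (-Real.log (c.R (n + 1))) :=
        mul_pos (by linarith) (by linarith)
      have : 0 ≤ -Real.log (t - x (n + 1)) := by linarith
      gcongr
    rw [abs_mul, abs_of_pos hα0]
    calc α * |wTildeDeriv (t - x (n + 1))| ≤ α * (1 + eps (n + 1) / 2) := by
          gcongr; linarith
      _ ≤ (2 - 2 * eps (n + 1)) * (1 + eps (n + 1) / 2) := by gcongr
      _ < _ := by nlinarith
  · have h1 : |x (n + 1) - τ - x (n + 1)| ≤ c.R (n + 1) := by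
      rw [sub_sub_cancel_left, abs_neg, abs_of_pos hτ.1]; exact hτ.2
    rw [deriv_wTildeAt_of_near c (by linarith [hτ.1]) h1, sub_sub_cancel_left, wTildeDeriv_neg,
      hτv, mul_div_cancel₀ _ hα0.ne']

/-- The construction can be carried out for any admissible constants. -/
lemma nonempty_construction (hx_zero : x 0 = 0) (c : Constants x) :
    Nonempty (Construction x) := by
  choose A B hAB using fun (n : ℕ) (f : {f // StageInv x n f}) => f.2.exists_stepChoice c
  let st : (n : ℕ) → {f // StageInv x n f} := fun n =>
    Nat.rec ⟨_, stageInv_zero hx_zero⟩ (fun n f => ⟨_, f.2.succ (hAB n f)⟩) n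
  let α : ℕ → ℝ := fun n => Nat.casesOn n 1 fun k => A k (st k)
  let τ : ℕ → ℝ := fun n => Nat.casesOn n 1 fun k => B k (st k)
  have hst : ∀ n, approx x c.T c.R α τ n = (st n).1 := fun n => by
    induction n with
    | zero => rfl
    | succ n ih => rw [approx, ih]
  exact ⟨{ c with
    α := α
    τ := τ
    α_mem := fun n => (hAB n (st n)).α_mem
    α_steep := fun n => (hAB n (st n)).steep
    τ_mem := fun n => (hAB n (st n)).τ_mem
    τ_join := fun n => by rw [hst n]; exact (hAB n (st n)).join }⟩

namespace Construction

variable (c : Construction x)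

lemma stepChoice (n : ℕ) : StepChoice c.toConstants n (c.w n) (c.α (n + 1)) (c.τ (n + 1)) :=
  ⟨c.α_mem n, c.α_steep n, c.τ_mem n, c.τ_join n⟩

lemma stageInv (hx_zero : x 0 = 0) (n : ℕ) : StageInv x n (c.w n) := by
  induction n with
  | zero => exact stageInv_zero hx_zero
  | succ n ih => exact ih.succ (c.stepChoice n)

lemma exists_stepHyp (hx_zero : x 0 = 0) (n : ℕ) : ∃ F, StepHyp (c.w n) F (x (n + 1)) (c.T (n + 1))
    (c.R (n + 1)) (c.α (n + 1)) (c.τ (n + 1)) (stepSize (n + 1)) := by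
  obtain ⟨F, hF⟩ := (c.stageInv hx_zero n).slope
  exact ⟨F, (c.stepChoice n).stepHyp hF⟩

end Construction

/-! ### Dini derivatives -/

lemma nhdsWithin_Icc_diff {a b s : ℝ} (hs : s ∈ Ioo a b) : 𝓝[Icc a b \ {s}] s = 𝓝[≠] s := by
  rw [sdiff_eq]
  exact nhdsWithin_inter_of_mem (nhdsWithin_le_nhds (Icc_mem_nhds hs.1 hs.2))

lemma lowerDini_le_neg_one_iff {a b : ℝ} {u : ℝ → ℝ} {s : ℝ} :
    lowerDini a b u s ≤ -1 ↔ 1 ≤ upperDini a b (-u) s := by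
  have : upperDini a b (-u) s = -lowerDini a b u s := by
    unfold upperDini lowerDini
    rw [← EReal.limsup_neg]
    congr 1
    ext t
    rw [Pi.neg_apply, Pi.neg_apply, Pi.neg_apply, ← EReal.coe_neg]
    congr 1
    ring
  rw [this, EReal.le_neg]

/-- The condition `1 ≤ upperDini` as a countable intersection of open conditions. -/
lemma one_le_upperDini_iff {a b : ℝ} {u : ℝ → ℝ} {s : ℝ} : 1 ≤ upperDini a b u s ↔
    ∀ k : ℕ, ∃ t ∈ Icc a b, t ≠ s ∧ |t - s| < 1 / ((k : ℝ) + 1) ∧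
      1 - 1 / ((k : ℝ) + 1) < (u t - u s) / (t - s) := by
  unfold upperDini
  rw [le_limsup_iff]
  constructor
  · intro h k
    have hk : (0 : ℝ) < 1 / ((k : ℝ) + 1) := Nat.one_div_pos_of_nat
    have h1 : ((1 - 1 / ((k : ℝ) + 1) : ℝ) : EReal) < 1 := by
      exact_mod_cast (by linarith : 1 - 1 / ((k : ℝ) + 1) < 1)
    have h2 : ∀ᶠ t in 𝓝[Icc a b \ {s}] s, |t - s| < 1 / ((k : ℝ) + 1) :=
      nhdsWithin_le_nhds (Metric.ball_mem_nhds s hk)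
    obtain ⟨t, ht, ht2, ht3⟩ := ((h _ h1).and_eventually (h2.and self_mem_nhdsWithin)).exists
    exact ⟨t, ht3.1, ht3.2, ht2, EReal.coe_lt_coe_iff.1 ht⟩
  · intro h y hy
    obtain ⟨r, hyr, hr⟩ := EReal.lt_iff_exists_real_btwn.1 hy
    have hr1 : r < 1 := by exact_mod_cast hr
    rw [Filter.frequently_iff]
    intro U hU
    obtain ⟨ε, hε, hU⟩ := Metric.mem_nhdsWithin_iff.1 hU
    obtain ⟨k, hk⟩ := exists_nat_one_div_lt (lt_min hε (sub_pos.2 hr1))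
    obtain ⟨t, ht, hts, h1, h2⟩ := h k
    refine ⟨t, hU ⟨h1.trans (hk.trans_le (min_le_left _ _)), ht, hts⟩, hyr.trans ?_⟩
    have := hk.trans_le (min_le_right _ _)
    exact EReal.coe_lt_coe_iff.2 (by linarith)

lemma isGδ_one_le_upperDini {a b : ℝ} {u : ℝ → ℝ} (hu : ∀ s ∈ Ioo a b, ContinuousAt u s) :
    IsGδ {s | s ∈ Ioo a b ∧ 1 ≤ upperDini a b u s} := by
  have : {s | s ∈ Ioo a b ∧ 1 ≤ upperDini a b u s} = ⋂ k : ℕ, {s | s ∈ Ioo a b ∧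
      ∃ t ∈ Icc a b, t ≠ s ∧ |t - s| < 1 / ((k : ℝ) + 1) ∧
      1 - 1 / ((k : ℝ) + 1) < (u t - u s) / (t - s)} := by
    ext s
    rw [mem_iInter]
    constructor
    · rintro ⟨hs, h⟩ k
      exact ⟨hs, one_le_upperDini_iff.1 h k⟩
    · intro h
      exact ⟨(h 0).1, one_le_upperDini_iff.2 fun k => (h k).2⟩
  rw [this]
  refine IsGδ.iInter_of_isOpen fun k => isOpen_iff_mem_nhds.2 ?_
  rintro s ⟨hs, t, ht, hts, h1, h2⟩
  have c1 : ContinuousAt (fun s => |t - s|) s := by fun_prop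
  have c2 : ContinuousAt (fun s => (u t - u s) / (t - s)) s :=
    (continuousAt_const.sub (hu s hs)).div (continuousAt_const.sub continuousAt_id)
      (sub_ne_zero.2 hts)
  filter_upwards [Ioo_mem_nhds hs.1 hs.2, c1.eventually (gt_mem_nhds h1),
    c2.eventually (lt_mem_nhds h2), eventually_ne_nhds hts.symm] with r hr k1 k2 k3
  exact ⟨hr, t, ht, k3.symm, k1, k2⟩

lemma isGδ_singularSet {u : ℝ → ℝ} (hu : ∀ s ∈ Ioo (-halfLen) halfLen, ContinuousAt u s) :
    IsGδ (singularSet u) := by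
  have : singularSet u = {s | s ∈ Ioo (-halfLen) halfLen ∧ 1 ≤ upperDini (-halfLen) halfLen u s} ∩
      {s | s ∈ Ioo (-halfLen) halfLen ∧ 1 ≤ upperDini (-halfLen) halfLen (-u) s} := by
    ext s
    simp only [singularSet, lowerDini_le_neg_one_iff, mem_inter_iff, mem_ofPred_eq]
    tauto
  rw [this]
  exact (isGδ_one_le_upperDini hu).inter (isGδ_one_le_upperDini fun s hs => (hu s hs).neg)

/-- If `u t = u s + α * wTilde (t - s) + o (t - s)` near `s`, then the difference quotients of `u`
at the points `s + tripleExp (θ + 2 π j)` tend to `α * sin θ`. -/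
lemma one_le_upperDini_of_approx {a b s α θ : ℝ} {u : ℝ → ℝ} (hs : s ∈ Ioo a b)
    (hθ : 1 ≤ α * Real.sin θ)
    (h : ∀ e > 0, ∀ᶠ t in 𝓝 s, |u t - u s - α * wTilde (t - s)| ≤ e * |t - s|) :
    1 ≤ upperDini a b u s := by
  rw [one_le_upperDini_iff]
  intro k
  have hk : (0 : ℝ) < 1 / ((k : ℝ) + 1) := Nat.one_div_pos_of_nat
  have hlim : Tendsto (fun j : ℕ => s + tripleExp (θ + j * (2 * Real.pi))) atTop (𝓝 s) := by
    have h1 : Tendsto (fun j : ℕ => θ + j * (2 * Real.pi)) atTop atTop :=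
      tendsto_atTop_add_const_left _ _
        (tendsto_natCast_atTop_atTop.atTop_mul_const (by positivity))
    simpa using (tendsto_tripleExp.comp h1).const_add s
  have hIcc : ∀ᶠ t in 𝓝 s, t ∈ Icc a b := Icc_mem_nhds hs.1 hs.2
  have hball : ∀ᶠ t in 𝓝 s, |t - s| < 1 / ((k : ℝ) + 1) := Metric.ball_mem_nhds s hk
  obtain ⟨j, h1, h2, h3⟩ := (hlim.eventually ((h _ (half_pos hk)).and (hIcc.and hball))).exists
  have hp := tripleExp_pos (θ + j * (2 * Real.pi))
  refine ⟨_, h2, by linarith, h3, ?_⟩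
  rw [add_sub_cancel_left] at h1 ⊢
  rw [wTilde_tripleExp, Real.sin_add_nat_mul_two_pi, abs_of_pos hp] at h1
  rw [lt_div_iff₀ hp]
  have h4 := (abs_le.1 h1).1
  nlinarith [mul_pos hk hp]

lemma not_differentiableAt_of_dini {a b s : ℝ} {u : ℝ → ℝ} (hs : s ∈ Ioo a b)
    (h1 : 1 ≤ upperDini a b u s) (h2 : lowerDini a b u s ≤ -1) : ¬ DifferentiableAt ℝ u s := by
  intro h
  have h3 := hasDerivAt_iff_tendsto_slope.1 h.hasDerivAt
  rw [← nhdsWithin_Icc_diff hs] at h3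
  have h4 : Tendsto (fun t : ℝ => (((u t - u s) / (t - s) : ℝ) : EReal)) (𝓝[Icc a b \ {s}] s)
      (𝓝 ((deriv u s : ℝ) : EReal)) := by
    refine (continuous_coe_real_ereal.tendsto _).comp (h3.congr fun t => ?_)
    rw [slope_def_field]
  have : (𝓝[Icc a b \ {s}] s).NeBot := by rw [nhdsWithin_Icc_diff hs]; infer_instance
  rw [upperDini, h4.limsup_eq] at h1
  rw [lowerDini, h4.liminf_eq] at h2
  have h5 : (1 : ℝ) ≤ deriv u s := by exact_mod_cast h1
  have h6 : deriv u s ≤ (-1 : ℝ) := by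
    rwa [← EReal.coe_le_coe_iff, EReal.coe_neg, EReal.coe_one]
  linarith

/-- A `Gδ` set whose closure contains a nondegenerate interval is not meagre, by Baire. -/
lemma not_isMeagre_of_isGδ {S : Set ℝ} {a b : ℝ} (hab : a < b) (hS : IsGδ S)
    (hd : Icc a b ⊆ closure S) : ¬ IsMeagre S := by
  intro hm
  have h1 : IsGδ (S ∪ (Icc a b)ᶜ) := hS.union isClosed_Icc.isOpen_compl.isGδ
  have h2 : Dense (S ∪ (Icc a b)ᶜ) := fun t => by
    by_cases ht : t ∈ Icc a b
    · exact closure_mono subset_union_left (hd ht)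
    · exact subset_closure (Or.inr ht)
  have h3 : Dense (Sᶜ ∩ (S ∪ (Icc a b)ᶜ)) :=
    dense_of_mem_residual (inter_mem hm (residual_of_dense_Gδ h1 h2))
  obtain ⟨t, ht, h4, h5⟩ := h3.inter_open_nonempty _ isOpen_Ioo (nonempty_Ioo.2 hab)
  exact h5.elim h4 fun h => h (Ioo_subset_Icc_self ht)

/-! ### The limit function -/

namespace Construction

variable {x : ℕ → ℝ} (c : Construction x)

lemma w_succ_eq (hx_zero : x 0 = 0) {n : ℕ} {t : ℝ} (ht : c.T (n + 1) ≤ |t - x (n + 1)|) :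
    c.w (n + 1) t = c.w n t := by
  obtain ⟨F, h⟩ := c.exists_stepHyp hx_zero n
  exact h.insertCopy_of_abs_ge ht

lemma abs_w_succ_sub_le (hx_zero : x 0 = 0) (n : ℕ) (t : ℝ) :
    |c.w (n + 1) t - c.w n t| ≤ (1 / 2) ^ (n + 1) * c.T (n + 1) := by
  obtain ⟨F, h⟩ := c.exists_stepHyp hx_zero n
  refine (h.abs_insertCopy_sub_le t).trans ?_
  have hT := h.T_pos
  have h1 : c.T (n + 1) ^ 2 ≤ c.T (n + 1) := by nlinarith [h.T_lt_one]
  exact mul_le_mul (stepSize_le_pow _) h1 (by positivity) (by positivity)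

/-- The later modifications are small compared with the distance to `x_n`: they take place on
intervals of radius `T_{k+1}` at distance more than `T_{k+1}` from `x_n`. -/
lemma abs_w_succ_sub_le_mul (hx_zero : x 0 = 0) {n k : ℕ} (hnk : n ≤ k) (t : ℝ) :
    |c.w (k + 1) t - c.w k t| ≤ (1 / 2) ^ (k + 1) * |t - x n| := by
  rcases le_or_gt (c.T (k + 1)) |t - x (k + 1)| with h | h
  · rw [c.w_succ_eq hx_zero h, sub_self, abs_zero]
    positivity
  · have h1 := c.sigma_le h.le hnk
    rw [abs_sub_comm] at h1
    refine (c.abs_w_succ_sub_le hx_zero k t).trans ?_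
    gcongr
    exact (c.T_sigma k).le.trans h1

lemma exists_limit (hx_zero : x 0 = 0) : ∃ w : ℝ → ℝ, TendstoUniformlyOn c.w w atTop dom := by
  have hdist : ∀ t n, dist (c.w n t) (c.w (n + 1) t) ≤ 1 / 2 * (1 / 2) ^ n := fun t n => by
    rw [dist_comm, Real.dist_eq, ← pow_succ']
    refine (c.abs_w_succ_sub_le hx_zero n t).trans ?_
    exact mul_le_of_le_one_right (by positivity) (c.T_mem _).2.le
  choose w hw using fun t => cauchySeq_tendsto_of_complete
    (cauchySeq_of_le_geometric (1 / 2) (1 / 2) (by norm_num) (hdist t))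
  refine ⟨w, Metric.tendstoUniformlyOn_iff.2 fun e he => ?_⟩
  have hpow := (tendsto_pow_atTop_nhds_zero_of_lt_one (r := (1 / 2 : ℝ)) (by norm_num)
    (by norm_num)).eventually (gt_mem_nhds he)
  filter_upwards [hpow] with n hn t _
  have := dist_le_of_le_geometric_of_tendsto (1 / 2) (1 / 2) (by norm_num) (hdist t) (hw t) n
  rw [dist_comm]
  refine this.trans_lt (lt_of_eq_of_lt ?_ hn)
  ring

lemma abs_limit_sub_le (hx_zero : x 0 = 0) {w : ℝ → ℝ} {n J : ℕ} (hnJ : n ≤ J) {t : ℝ}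
    (hw : Tendsto (fun k => c.w k t) atTop (𝓝 (w t))) :
    |w t - c.w J t| ≤ (1 / 2) ^ J * |t - x n| := by
  have hdist : ∀ k, dist (c.w (J + k) t) (c.w (J + (k + 1)) t) ≤
      (1 / 2) ^ (J + 1) * |t - x n| * (1 / 2) ^ k := fun k => by
    rw [dist_comm, Real.dist_eq]
    refine (c.abs_w_succ_sub_le_mul hx_zero (hnJ.trans (Nat.le_add_right J k)) t).trans
      (le_of_eq ?_)
    ring
  have hw' : Tendsto (fun k => c.w (J + k) t) atTop (𝓝 (w t)) := by
    simpa only [add_comm] using (tendsto_add_atTop_iff_nat J).2 hw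
  have := dist_le_of_le_geometric_of_tendsto (1 / 2) _ (by norm_num) hdist hw' 0
  rw [dist_comm, Real.dist_eq] at this
  refine this.trans (le_of_eq ?_)
  ring

lemma eventually_w_eq (hx_zero : x 0 = 0) {n J : ℕ} (hnJ : n ≤ J) :
    ∀ᶠ t in 𝓝 (x n), c.w J t = c.w n t := by
  induction J, hnJ using Nat.le_induction with
  | base => exact Eventually.of_forall fun _ => rfl
  | succ J hnJ ih =>
    have hcont : ContinuousAt (fun t => |t - x (J + 1)|) (x n) := by fun_prop
    filter_upwards [ih, hcont.eventually (lt_mem_nhds (c.T_lt_abs hnJ))] with t h1 h2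
    rw [c.w_succ_eq hx_zero h2.le, h1]

/-- Near `x_n` the function `w_n` is a scaled copy of `wTilde`. -/
lemma exists_w_near (hx_zero : x 0 = 0) (n : ℕ) : ∃ α b, 1 ≤ α ∧
    ∀ᶠ t in 𝓝 (x n), c.w n t = α * wTilde (t - x n) + b := by
  cases n with
  | zero => exact ⟨1, 0, le_rfl, Eventually.of_forall fun t => by simp [w, approx, wTildeAt]⟩
  | succ n =>
    obtain ⟨F, h⟩ := c.exists_stepHyp hx_zero n
    refine ⟨c.α (n + 1), c.w n (x (n + 1)), (c.α_mem n).1, ?_⟩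
    have hcont : ContinuousAt (fun t => |t - x (n + 1)|) (x (n + 1)) := by fun_prop
    filter_upwards [hcont.eventually (gt_mem_nhds (by simpa using h.τ_mem.1))] with t ht
    exact h.insertCopy_near ht

/-- The limit function inherits the behaviour of `w_n` near `x_n` up to `o (t - x_n)`. -/
lemma exists_limit_near (hx_zero : x 0 = 0) {w : ℝ → ℝ}
    (hw : ∀ t ∈ dom, Tendsto (fun k => c.w k t) atTop (𝓝 (w t))) (n : ℕ) :
    ∃ α, 1 ≤ α ∧ ∀ e > 0, ∀ᶠ t in 𝓝 (x n),
      |w t - w (x n) - α * wTilde (t - x n)| ≤ e * |t - x n| := by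
  obtain ⟨α, b, hα, hb⟩ := c.exists_w_near hx_zero n
  have hxn := c.center_mem n
  have hxw : w (x n) = b := by
    have h1 := c.abs_limit_sub_le hx_zero (le_refl n) (hw (x n) (Ioo_subset_Icc_self hxn))
    rw [sub_self, abs_zero, mul_zero] at h1
    have h2 := hb.self_of_nhds
    rw [sub_self, wTilde_zero, mul_zero, zero_add] at h2
    rw [← h2]
    exact sub_eq_zero.1 (abs_nonpos_iff.1 h1)
  refine ⟨α, hα, fun e he => ?_⟩
  obtain ⟨J, hJe, hJ⟩ := (((tendsto_pow_atTop_nhds_zero_of_lt_one (r := (1 / 2 : ℝ)) (by norm_num)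
    (by norm_num)).eventually (gt_mem_nhds he)).and (eventually_ge_atTop n)).exists
  filter_upwards [hb, c.eventually_w_eq hx_zero hJ, Ioo_mem_nhds hxn.1 hxn.2] with t h1 h2 h3
  have h4 := c.abs_limit_sub_le hx_zero hJ (hw t (Ioo_subset_Icc_self h3))
  rw [h2, h1] at h4
  rw [hxw, sub_sub, add_comm b]
  exact h4.trans (by gcongr)

lemma dini_limit (hx_zero : x 0 = 0) {w : ℝ → ℝ}
    (hw : ∀ t ∈ dom, Tendsto (fun k => c.w k t) atTop (𝓝 (w t))) (n : ℕ) :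
    1 ≤ upperDini (-halfLen) halfLen w (x n) ∧ lowerDini (-halfLen) halfLen w (x n) ≤ -1 := by
  obtain ⟨α, hα, h⟩ := c.exists_limit_near hx_zero hw n
  have hxn := c.center_mem n
  refine ⟨one_le_upperDini_of_approx (θ := Real.pi / 2) hxn (by simpa using hα) h, ?_⟩
  rw [lowerDini_le_neg_one_iff]
  refine one_le_upperDini_of_approx (α := -α) (θ := -(Real.pi / 2)) hxn (by simpa using hα)
    fun e he => ?_
  filter_upwards [h e he] with t ht
  rwa [Pi.neg_apply, Pi.neg_apply, ← abs_neg,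
    show -(-w t - -w (x n) - -α * wTilde (t - x n)) = w t - w (x n) - α * wTilde (t - x n) by ring]

end Construction

end SingularMinimizer

theorem proposition4p1 (x : ℕ → ℝ)
    (hx_mem : ∀ n, x n ∈ Set.Ioo (-SingularMinimizer.halfLen) SingularMinimizer.halfLen)
    (hx_inj : Function.Injective x) (hx_zero : x 0 = 0) :
    Nonempty (SingularMinimizer.Construction x) ∧
    ∀ c : SingularMinimizer.Construction x,
      (∃ w : ℝ → ℝ, TendstoUniformlyOn c.w w Filter.atTop SingularMinimizer.dom) ∧
      ∀ w : ℝ → ℝ, TendstoUniformlyOn c.w w Filter.atTop SingularMinimizer.dom →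
        (∀ n,
          1 ≤ SingularMinimizer.upperDini
            (-SingularMinimizer.halfLen) SingularMinimizer.halfLen w (x n) ∧
          SingularMinimizer.lowerDini
            (-SingularMinimizer.halfLen) SingularMinimizer.halfLen w (x n) ≤ -1) ∧
        (∀ n, ¬ DifferentiableAt ℝ w (x n)) ∧
        (SingularMinimizer.dom ⊆ closure (Set.range x) →
          IsGδ (SingularMinimizer.singularSet w) ∧
          SingularMinimizer.dom ⊆ closure (SingularMinimizer.singularSet w) ∧
          ¬ IsMeagre (SingularMinimizer.singularSet w)) := by
  open SingularMinimizer in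
  obtain ⟨c₀⟩ := nonempty_constants hx_mem hx_inj hx_zero
  refine ⟨nonempty_construction hx_zero c₀, fun c => ⟨c.exists_limit hx_zero, fun w hw => ?_⟩⟩
  have hdini := c.dini_limit hx_zero fun t ht => hw.tendsto_at ht
  refine ⟨hdini, fun n => not_differentiableAt_of_dini (hx_mem n) (hdini n).1 (hdini n).2,
    fun hdense => ?_⟩
  have hcont : ∀ s ∈ Ioo (-halfLen) halfLen, ContinuousAt w s := fun s hs => by
    have h := (hw.mono Ioo_subset_Icc_self).continuousOn <| Frequently.of_forall fun n t ht =>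
      ((c.stageInv hx_zero n).cont t ht).continuousWithinAt
    exact h.continuousAt (Ioo_mem_nhds hs.1 hs.2)
  have hG := isGδ_singularSet hcont
  have hd : dom ⊆ closure (singularSet w) :=
    hdense.trans (closure_mono (range_subset_iff.2 fun n => ⟨hx_mem n, hdini n⟩))
  exact ⟨hG, hd, not_isMeagre_of_isGδ (by linarith [halfLen_pos]) hG hd⟩
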